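/- An entire function $E$ is of Hermite--Biehler class if $|E(\bar z)|<|E(z)|$ for all $z$ in the open upper half-plane $\mathbb{C}^+$. Write $f^*(z)=\overline{f(\bar z)}$. Let $\mathcal H(E)$ be the de Branges space of all entire $f$ with $\int_{\mathbb R}|f(t)/E(t)|^2\,dt<\infty$ such that $f/E$ and $f^*/E$ are of bounded type in $\mathbb{C}^+$ (quotients of two bounded analytic functions) and of nonpositive mean type, where the mean type of $u$ is $\limsup_{y\to+\infty} y^{-1}\log|u(iy)|$. Its inner product is $\langle f,g\rangle_E=\int_{\mathbb R} f(t)\overline{g(t)}\,|E(t)|^{-2}\,dt$. Put $$K_E(w,z)=\frac{\overline{E(w)}E(z)-E(\bar w)E^*(z)}{2\pi i(\bar w-z)},$$ with the removable singularity at $z=\bar w$ filled in by continuity. Let $E,F$ be of Hermite--Biehler class. Then: 1. The maps $\mathcal I:\mathcal H(E)\to\mathcal H(EF)$, $f\mapsto fF$, and $\mathcal J:\mathcal H(F)\to\mathcal H(EF)$, $g\mapsto gE^*$, are well defined and preserve inner products. 2. The images of $\mathcal I$ and $\mathcal J$ are orthogonal: $\langle fF,\,gE^*\rangle_{EF}=0$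 for all $f\in\mathcal H(E)$ and $g\in\mathcal H(F)$. 3. Together the images span $\mathcal H(EF)$: a function $h$ belongs to $\mathcal H(EF)$ if and only if $h=fF+gE^*$ for a unique pair $f\in\mathcal H(E)$, $g\in\mathcal H(F)$. 4. $K_E$, $K_F$ and $K_{EF}$ are the reproducing kernels of $\mathcal H(E)$, $\mathcal H(F)$ and $\mathcal H(EF)$ (for $G\in\{E,F,EF\}$, every $w\in\mathbb C$ and every $f\in\mathcal H(G)$, one has $K_G(w,\cdot)\in\mathcal H(G)$ and $f(w)=\langle f,K_G(w,\cdot)\rangle_G$), and for every $w\in\mathbb C$ $$K_{EF}(w,\cdot)=\overline{F(w)}\,F\,K_E(w,\cdot)+E(\bar w)\,E^*\,K_F(w,\cdot).$$ -/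

import Mathlib

open scoped ComplexConjugate

noncomputable section

namespace DeBranges

/-- The open upper half-plane `ℂ⁺`. -/
def upperHalf : Set ℂ := {z | 0 < z.im}

/-- `E` is of Hermite-Biehler class: entire, with `|E(z̄)| < |E(z)|` in the open upper half-plane.
Real zeros are allowed. -/
def IsHermiteBiehler (E : ℂ → ℂ) : Prop :=
  Differentiable ℂ E ∧ ∀ z ∈ upperHalf, ‖E (conj z)‖ < ‖E z‖

/-- The function `f*(z) = conj (f (conj z))`. -/
def starFn (f : ℂ → ℂ) : ℂ → ℂ := fun z => conj (f (conj z))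

/-- `f` is analytic and of bounded type in the upper half-plane: a quotient `P / Q` of two bounded
analytic functions there (`Q` not identically zero; its zeros are cancelled by those of `P`). -/
def IsBoundedType (f : ℂ → ℂ) : Prop :=
  DifferentiableOn ℂ f upperHalf ∧
  ∃ P Q : ℂ → ℂ, DifferentiableOn ℂ P upperHalf ∧ DifferentiableOn ℂ Q upperHalf ∧
    (∃ C : ℝ, ∀ z ∈ upperHalf, ‖P z‖ ≤ C) ∧ (∃ C : ℝ, ∀ z ∈ upperHalf, ‖Q z‖ ≤ C) ∧
    (∃ z ∈ upperHalf, Q z ≠ 0) ∧ ∀ z ∈ upperHalf, f z * Q z = P z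

/-- Mean type `limsup_{y → +∞} log |f(iy)| / y` in the upper half-plane, an extended real
(with `log 0 = -∞`). -/
def meanType (f : ℂ → ℂ) : EReal :=
  Filter.limsup (fun y : ℝ => ENNReal.log ‖f (Complex.I * (y : ℂ))‖ₑ / (y : EReal)) Filter.atTop

/-- The de Branges space `H(E)`, as a set of entire functions. -/
def space (E : ℂ → ℂ) : Set (ℂ → ℂ) :=
  {f | Differentiable ℂ f ∧
    MeasureTheory.MemLp (fun t : ℝ => f (t : ℂ) / E (t : ℂ)) 2 MeasureTheory.volume ∧
    IsBoundedType (fun z => f z / E z) ∧ meanType (fun z => f z / E z) ≤ 0 ∧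
    IsBoundedType (fun z => starFn f z / E z) ∧ meanType (fun z => starFn f z / E z) ≤ 0}

/-- The inner product `⟨f, g⟩_E = ∫ f(t) conj(g(t)) / |E(t)|² dt` of `H(E)`,
linear in the first argument. -/
def ip (E f g : ℂ → ℂ) : ℂ :=
  ∫ t : ℝ, f (t : ℂ) * conj (g (t : ℂ)) / ((‖E (t : ℂ)‖ ^ 2 : ℝ) : ℂ)

/-- The numerator `conj(E(w)) E(z) - E(w̄) E*(z)` of the kernel; it vanishes at `z = w̄`. -/
def kernelNum (E : ℂ → ℂ) (w z : ℂ) : ℂ :=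
  conj (E w) * E z - E (conj w) * starFn E z

/-- The kernel `K_E(w, z) = (conj(E(w)) E(z) - E(w̄) E*(z)) / (2πi (w̄ - z))`, with the removable
singularity at `z = w̄` filled in by the limit. -/
def kernel (E : ℂ → ℂ) (w : ℂ) : ℂ → ℂ := fun z =>
  if z = conj w then -deriv (kernelNum E w) (conj w) / (2 * (Real.pi : ℂ) * Complex.I)
  else kernelNum E w z / (2 * (Real.pi : ℂ) * Complex.I * (conj w - z))

/-- `K` is the reproducing kernel of `H(E)`: `K(w, ·) ∈ H(E)` and `f(w) = ⟨f, K(w, ·)⟩_E` for all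
`w` and all `f ∈ H(E)`. -/
def IsReproducingKernel (E : ℂ → ℂ) (K : ℂ → ℂ → ℂ) : Prop :=
  ∀ w : ℂ, K w ∈ space E ∧ ∀ f ∈ space E, f w = ip E f (K w)

/-- The map `I : f ↦ f F`. -/
def mapI (F f : ℂ → ℂ) : ℂ → ℂ := fun z => f z * F z

/-- The map `J : g ↦ g E*`. -/
def mapJ (E g : ℂ → ℂ) : ℂ → ℂ := fun z => g z * starFn E z

end DeBranges

end

/-! The map `f ↦ f / E` embeds `H(E)` isometrically in `L²(ℝ)`. Under these embeddings `I` is the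
identity and `J` is multiplication by `E*/E`, which is unimodular almost everywhere on the line and
bounded by 1 in `ℂ⁺`. This gives well-definedness and isometry.

Everything else follows from reproducing kernels. The kernel identity comes from adding and
subtracting one cross term in the numerator. Evaluate `J g` at `w ∈ ℂ⁺` through `K_EF(w, ·)` and
expand by the identity: the `K_F` part alone already yields `g(w) E*(w)`, so `J g` is orthogonal to
`I K_E(w, ·)` (`inner_kernelElt_mapJLin`). Since `H(E)` is closed in `L²`, projecting upgrades this
to orthogonality to all of `H(E)`. A function of `H(EF)` minus its two projections is then
orthogonal to both images, hence to every `K_EF(w, ·)`, hence zero.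

The analytic core is Cauchy's formula for `f / E` (`IsHermiteBiehler.cauchyInt_eq`). A function `u`
of bounded type in `ℂ⁺` grows at most like `exp(A(1+|z|²)/Im z)` (`IsBoundedType.exists_growth`).
With bounded boundary values this forces finite exponential type (`norm_le_exp_im_of_growth`).
Boundary values that are only square integrable become bounded after averaging over horizontal
segments, and nonpositive mean type then removes the exponential factor (`cauchyInt_eq_of_growth`).
Conversely, an `L²` Cauchy integral vanishing in the lower half-plane is of bounded type and
nonpositive mean type (`isSmirnov_of_cauchyInt`); this makes the image of `H(E)` in `L²` closed. -/

noncomputable section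
namespace DeBranges
open Complex Metric Set Filter Topology

/-! ### Growth of functions of bounded type. -/

/-- Harnack's inequality for `log ‖g‖`, where `g` is zero-free and bounded by one. -/
theorem log_norm_ge_of_ne_zero {g : ℂ → ℂ} {ρ : ℝ} {w : ℂ}
    (hg : AnalyticOnNhd ℂ g (closedBall 0 ρ)) (h0 : ∀ z ∈ closedBall 0 ρ, g z ≠ 0)
    (h1 : ∀ z ∈ closedBall 0 ρ, ‖g z‖ ≤ 1) (hw : w ∈ ball 0 ρ) :
    (ρ + ‖w‖) / (ρ - ‖w‖) * Real.log ‖g 0‖ ≤ Real.log ‖g w‖ := by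
  have hρ : 0 < ρ := pos_of_mem_ball hw
  have hw' : ‖w‖ < ρ := by simpa using hw
  have hh : InnerProductSpace.HarmonicOnNhd (fun z => Real.log ‖g z‖) (closedBall 0 ρ) :=
    fun z hz => (hg z hz).harmonicAt_log_norm (h0 z hz)
  have hcont : ContinuousOn (fun z => Real.log ‖g z‖) (closedBall 0 ρ) :=
    hg.continuousOn.norm.log fun z hz => by simpa using h0 z hz
  have hsph : sphere (0 : ℂ) |ρ| ⊆ closedBall 0 ρ := by
    rw [abs_of_pos hρ]; exact sphere_subset_closedBall
  have e1 := hh.circleAverage_re_herglotzRieszKernel_smul hw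
  have e2 : Real.circleAverage (fun z => Real.log ‖g z‖) 0 ρ = Real.log ‖g 0‖ := by
    have := InnerProductSpace.HarmonicOnNhd.circleAverage_eq (f := fun z => Real.log ‖g z‖)
      (c := 0) (R := ρ) (by rwa [abs_of_pos hρ])
    simpa using this
  rw [← e2, ← smul_eq_mul, ← Real.circleAverage_fun_smul, ← e1]
  refine Real.circleAverage_mono ?_ ?_ fun z hz => ?_
  · exact (hcont.mono hsph).circleIntegrable'.const_smul
  · refine ContinuousOn.circleIntegrable' (ContinuousOn.smul ?_ (hcont.mono hsph))
    exact Complex.continuous_re.comp_continuousOn (continuousOn_herglotzRieszKernel_sphere hw)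
  · have hz' : z ∈ sphere (0 : ℂ) ρ := by rwa [abs_of_pos hρ] at hz
    -- Because `log ‖g‖ ≤ 0`, the upper bound for the Poisson kernel produces a lower bound for the
    -- integral.
    have k := re_herglotzRieszKernel_le hz' hw
    have l : Real.log ‖g z‖ ≤ 0 :=
      Real.log_nonpos (norm_nonneg _) (h1 z (sphere_subset_closedBall hz'))
    simp only [smul_eq_mul, Pi.smul_apply', Function.comp_apply, herglotzRieszKernel_def]
    simp only [sub_zero] at k ⊢
    nlinarith

/-- On the circle `R² = z z̄`, so the numerator is `z` times the conjugate of `z - u`. Replacing a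
zero factor `z - u` by this one therefore leaves boundary moduli unchanged. -/
theorem norm_blaschke_den {R : ℝ} (hR : 0 < R) {u z : ℂ} (hz : ‖z‖ = R) :
    ‖((R : ℂ) ^ 2 - conj u * z) / R‖ = ‖z - u‖ := by
  have h : ((R : ℂ) ^ 2 - conj u * z) = z * conj (z - u) := by
    rw [map_sub, mul_sub, mul_conj, normSq_eq_norm_sq, hz]; push_cast; ring
  rw [h, norm_div, norm_mul, RCLike.norm_conj, hz, Complex.norm_real, Real.norm_of_nonneg hR.le]
  field_simp

/-- `|R² - ūz|² - R²|z - u|² = (R² - |u|²)(R² - |z|²)`. -/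
theorem norm_sub_le_norm_blaschke_den {R : ℝ} (hR : 0 < R) {u z : ℂ} (hu : ‖u‖ ≤ R)
    (hz : ‖z‖ ≤ R) : ‖z - u‖ ≤ ‖((R : ℂ) ^ 2 - conj u * z) / R‖ := by
  rw [norm_div, Complex.norm_real, Real.norm_of_nonneg hR.le, le_div_iff₀ hR,
    ← sq_le_sq₀ (by positivity) (by positivity), mul_pow, ← normSq_eq_norm_sq,
    ← normSq_eq_norm_sq]
  rw [← sq_le_sq₀ (by positivity) (by positivity), ← normSq_eq_norm_sq] at hu hz
  simp only [normSq_apply, sub_re, sub_im, mul_re, mul_im, conj_re, conj_im] at *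
  have e1 : ((R : ℂ) ^ 2).re = R ^ 2 := by norm_cast
  have e2 : ((R : ℂ) ^ 2).im = 0 := by norm_cast
  rw [e1, e2]
  nlinarith [mul_nonneg (sub_nonneg.2 hu) (sub_nonneg.2 hz)]

theorem blaschke_den_ne_zero {R : ℝ} (hR : 0 < R) {u z : ℂ} (hu : ‖u‖ ≤ R)
    (hz : ‖z‖ < R) : ((R : ℂ) ^ 2 - conj u * z) / R ≠ 0 := by
  refine div_ne_zero ?_ (by exact_mod_cast hR.ne')
  rw [sub_ne_zero]
  intro h
  have h2 := congrArg norm h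
  rw [norm_mul, norm_pow, Complex.norm_real, Real.norm_of_nonneg hR.le, RCLike.norm_conj] at h2
  nlinarith [norm_nonneg u, norm_nonneg z]

/-- Division of a bounded analytic function by its Blaschke product. -/
theorem exists_zero_free_multiple {q v : ℂ → ℂ} {R : ℝ} (hR : 0 < R)
    (hq : AnalyticOnNhd ℂ q (closedBall 0 R)) (hv : AnalyticOnNhd ℂ v (closedBall 0 R))
    (hq1 : ∀ z ∈ closedBall 0 R, ‖q z‖ ≤ 1) (hvq : ∀ z ∈ closedBall 0 R, ‖v z * q z‖ ≤ 1)
    (hq0 : q 0 ≠ 0) :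
    ∃ g : ℂ → ℂ, AnalyticOnNhd ℂ g (closedBall 0 R) ∧ (∀ z ∈ ball 0 R, g z ≠ 0) ∧
      (∀ z ∈ closedBall 0 R, ‖g z‖ ≤ 1) ∧ (∀ z ∈ closedBall 0 R, ‖v z * g z‖ ≤ 1) ∧
      ‖q 0‖ ≤ ‖g 0‖ := by
  classical
  set B := closedBall (0 : ℂ) R
  have h0B : (0 : ℂ) ∈ B := mem_closedBall_self hR.le
  have hpre : IsPreconnected B := (convex_closedBall 0 R).isPreconnected
  have hord : ∀ u : B, meromorphicOrderAt q u ≠ ⊤ := by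
    intro u hu
    rw [(hq u u.2).meromorphicOrderAt_eq] at hu
    have hu' : analyticOrderAt q u = ⊤ := by simpa using hu
    have := hq.eqOn_zero_of_preconnected_of_eventuallyEq_zero hpre u.2
      (analyticOrderAt_eq_top.1 hu')
    exact hq0 (this h0B)
  have hfin := (MeromorphicOn.divisor q B).finiteSupport (isCompact_closedBall 0 R)
  obtain ⟨g, hg, hg0, hqg⟩ := hq.meromorphicOn.extract_zeros_poles hord hfin
  set D := MeromorphicOn.divisor q B
  have hD : ∀ u, 0 ≤ D u := fun u => MeromorphicOn.AnalyticOnNhd.divisor_nonneg hq u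
  have hDs : ∀ u ∈ hfin.toFinset, ‖u‖ ≤ R := by
    intro u hu
    have : u ∈ B := D.supportWithinDomain (by simpa using hu)
    simpa [B] using this
  set S := hfin.toFinset
  have hprod : (∏ᶠ u, (fun x : ℂ => x - u) ^ D u) = fun z => ∏ u ∈ S, (z - u) ^ (D u).toNat := by
    rw [finprod_eq_prod_of_mulSupport_subset (s := S)]
    · ext z
      rw [Finset.prod_apply]
      refine Finset.prod_congr rfl fun u _ => ?_
      rw [Pi.pow_apply, ← zpow_natCast, Int.toNat_of_nonneg (hD u)]
    · intro u hu
      by_contra h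
      have : D u = 0 := by simpa [S] using h
      simp [this] at hu
  rw [hprod] at hqg
  have han : AnalyticOnNhd ℂ (fun z => (∏ u ∈ S, (z - u) ^ (D u).toNat) * g z) B := by
    intro z hz
    refine AnalyticAt.mul ?_ (hg z hz)
    exact Finset.analyticAt_fun_prod _ fun u _ => by fun_prop
  have hqeq : ∀ z ∈ B, q z = (∏ u ∈ S, (z - u) ^ (D u).toNat) * g z := by
    have hcl : B = closure (ball 0 R) := (closure_ball 0 hR.ne').symm
    have h1 : ∀ᶠ z in 𝓝[≠] (0 : ℂ), q z = (∏ u ∈ S, (z - u) ^ (D u).toNat) * g z := by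
      have hm := mem_codiscreteWithin.1 hqg 0 h0B
      rw [disjoint_principal_right] at hm
      filter_upwards [hm, nhdsWithin_le_nhds (closedBall_mem_nhds (0 : ℂ) hR)] with z hz hzB
      by_contra hne
      exact hz ⟨hzB, fun h => hne (by simpa using h)⟩
    exact fun z hz => hq.eqOn_of_preconnected_of_frequently_eq han hpre h0B h1.frequently hz
  set b : ℂ → ℂ → ℂ := fun u z => ((R : ℂ) ^ 2 - conj u * z) / R
  -- Each zero factor of `q` is exchanged for its Blaschke denominator. Then `|G| = |q|` on the
  -- circle, so both bounds follow from the maximum principle. Zeros of `q` lying on the circle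
  -- itself remain, so `G` is zero-free only in the open disc.
  set G : ℂ → ℂ := fun z => (∏ u ∈ S, b u z ^ (D u).toNat) * g z
  have hGan : AnalyticOnNhd ℂ G B := by
    intro z hz
    refine AnalyticAt.mul ?_ (hg z hz)
    exact Finset.analyticAt_fun_prod _ fun u _ => by
      have : AnalyticAt ℂ (fun z => b u z) z := by
        have hRc : (R : ℂ) ≠ 0 := by exact_mod_cast hR.ne'
        simp only [b]; fun_prop (disch := assumption)
      exact this.pow _
  have hGsph : ∀ z ∈ sphere (0 : ℂ) R, ‖G z‖ = ‖q z‖ := by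
    intro z hz
    have hz' : ‖z‖ = R := by simpa using hz
    rw [hqeq z (sphere_subset_closedBall hz), norm_mul, norm_mul, norm_prod, norm_prod]
    congr 1
    refine Finset.prod_congr rfl fun u _ => ?_
    rw [norm_pow, norm_pow, norm_blaschke_den hR hz']
  have hfr : frontier (ball (0 : ℂ) R) = sphere 0 R := frontier_ball 0 hR.ne'
  have hmax : ∀ f : ℂ → ℂ, AnalyticOnNhd ℂ f B → (∀ z ∈ sphere (0 : ℂ) R, ‖f z‖ ≤ 1) →
      ∀ z ∈ B, ‖f z‖ ≤ 1 := by
    intro f hf hs z hz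
    refine norm_le_of_forall_mem_frontier_norm_le (isBounded_ball (x := (0 : ℂ)) (r := R))
      ?_ (C := 1) (fun z hz => hs z (hfr ▸ hz)) ?_
    · refine DifferentiableOn.diffContOnCl ?_
      rw [closure_ball 0 hR.ne']
      exact hf.differentiableOn
    · rwa [closure_ball 0 hR.ne']
  refine ⟨G, hGan, ?_, ?_, ?_, ?_⟩
  · intro z hz
    have hz' : ‖z‖ < R := by simpa using hz
    refine mul_ne_zero (Finset.prod_ne_zero_iff.2 fun u hu => pow_ne_zero _
      (blaschke_den_ne_zero hR (hDs u hu) hz')) (hg0 ⟨z, ball_subset_closedBall hz⟩)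
  · exact hmax G hGan fun z hz => hGsph z hz ▸ hq1 z (sphere_subset_closedBall hz)
  · refine hmax (fun z => v z * G z) (hv.mul hGan) fun z hz => ?_
    rw [norm_mul, hGsph z hz, ← norm_mul]
    exact hvq z (sphere_subset_closedBall hz)
  · rw [hqeq 0 h0B, norm_mul, norm_mul, norm_prod, norm_prod]
    refine mul_le_mul_of_nonneg_right (Finset.prod_le_prod (fun _ _ => norm_nonneg _)
      fun u hu => ?_) (norm_nonneg _)
    rw [norm_pow, norm_pow]
    exact pow_le_pow_left₀ (norm_nonneg _)
      (norm_sub_le_norm_blaschke_den hR (hDs u hu) (by simpa using hR.le)) _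

/-- Growth in the unit disc of an analytic quotient of bounded analytic functions. -/
theorem norm_le_exp_of_quotient_disc {q v : ℂ → ℂ} (hq : AnalyticOnNhd ℂ q (ball 0 1))
    (hv : AnalyticOnNhd ℂ v (ball 0 1)) (hq1 : ∀ z ∈ ball 0 1, ‖q z‖ ≤ 1)
    (hvq : ∀ z ∈ ball 0 1, ‖v z * q z‖ ≤ 1) (hq0 : q 0 ≠ 0) {w : ℂ} (hw : w ∈ ball 0 1) :
    ‖v w‖ ≤ Real.exp (4 / (1 - ‖w‖) * -Real.log ‖q 0‖) := by
  have hw1 : ‖w‖ < 1 := by simpa using hw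
  have hwn := norm_nonneg w
  -- Two radii with `‖w‖ < ρ < R < 1`: `R < 1` gives analyticity on a closed disc, and `ρ < R`
  -- avoids zeros of `g` on the circle of radius `R`. The Harnack factor is then `(1 + 3‖w‖)/(1 -
  -- ‖w‖) ≤ 4/(1 - ‖w‖)`.
  set ρ := (1 + ‖w‖) / 2 with hρd
  set R := (1 + ρ) / 2 with hRd
  have hρR : ρ < R := by linarith
  have hR1 : R < 1 := by linarith
  have hR0 : 0 < R := by linarith
  have hs : closedBall (0 : ℂ) R ⊆ ball 0 1 := closedBall_subset_ball hR1
  obtain ⟨g, hg, hg0, hg1, hvg, hgq⟩ := exists_zero_free_multiple hR0 (hq.mono hs) (hv.mono hs)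
    (fun z hz => hq1 z (hs hz)) (fun z hz => hvq z (hs hz)) hq0
  have hs2 : closedBall (0 : ℂ) ρ ⊆ ball 0 R := closedBall_subset_ball hρR
  have hs3 : closedBall (0 : ℂ) ρ ⊆ closedBall 0 R := closedBall_subset_closedBall hρR.le
  have hwρ : w ∈ ball (0 : ℂ) ρ := by simp; linarith
  have key := log_norm_ge_of_ne_zero (hg.mono hs3) (fun z hz => hg0 z (hs2 hz))
    (fun z hz => hg1 z (hs3 hz)) hwρ
  have hgw : g w ≠ 0 := hg0 w (hs2 (ball_subset_closedBall hwρ))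
  have hgwpos : 0 < ‖g w‖ := norm_pos_iff.2 hgw
  have hb := hvg w (hs3 (ball_subset_closedBall hwρ))
  rw [norm_mul] at hb
  have hq0pos : 0 < ‖q 0‖ := norm_pos_iff.2 hq0
  have hlq : Real.log ‖q 0‖ ≤ Real.log ‖g 0‖ := Real.log_le_log hq0pos hgq
  have hlq0 : Real.log ‖q 0‖ ≤ 0 := Real.log_nonpos (norm_nonneg _) (hq1 0 (by simp))
  have hcoef : (ρ + ‖w‖) / (ρ - ‖w‖) ≤ 4 / (1 - ‖w‖) := by
    rw [div_le_div_iff₀ (by linarith) (by linarith)]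
    nlinarith
  have hcoef0 : 0 ≤ (ρ + ‖w‖) / (ρ - ‖w‖) := div_nonneg (by linarith) (by linarith)
  calc ‖v w‖ ≤ ‖g w‖⁻¹ := by rw [← one_div, le_div_iff₀ hgwpos]; exact hb
    _ = Real.exp (-Real.log ‖g w‖) := by rw [Real.exp_neg, Real.exp_log hgwpos]
    _ ≤ _ := by
      gcongr
      nlinarith

theorem isOpen_upperHalf : IsOpen upperHalf := isOpen_lt continuous_const continuous_im

theorem convex_upperHalf : Convex ℝ upperHalf := convex_halfSpace_im_gt 0

/-- Growth in the upper half-plane of an analytic function of bounded type. -/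
theorem IsBoundedType.exists_growth {u : ℂ → ℂ} (hu : IsBoundedType u) :
    ∃ A : ℝ, 0 ≤ A ∧ ∀ z ∈ upperHalf, ‖u z‖ ≤ Real.exp (A * ((1 + ‖z‖ ^ 2) / z.im)) := by
  obtain ⟨hud, P, Q, hP, hQ, ⟨C₁, hC₁⟩, ⟨C₂, hC₂⟩, ⟨z₀, hz₀, hQ0⟩, huQ⟩ := hu
  have hz₀' : 0 < z₀.im := hz₀
  set C := max 1 (max C₁ C₂)
  have hC : 0 < C := lt_of_lt_of_le one_pos (le_max_left _ _)
  have hC0 : (C : ℂ) ≠ 0 := by exact_mod_cast hC.ne'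
  -- The Cayley map from the disc to the half-plane sending `0` to `z₀`, a point where the
  -- denominator `Q` does not vanish.
  set ψ : ℂ → ℂ := fun ζ => (z₀ - conj z₀ * ζ) / (1 - ζ) with hψ
  have hne : ∀ ζ ∈ ball (0 : ℂ) 1, 1 - ζ ≠ 0 := by
    intro ζ hζ h
    have : ζ = 1 := (sub_eq_zero.1 h).symm
    simp [this] at hζ
  have hψim : ∀ ζ, (ψ ζ).im = z₀.im * (1 - ‖ζ‖ ^ 2) / ‖1 - ζ‖ ^ 2 := by
    intro ζ
    rw [hψ]
    simp only [div_im, ← normSq_eq_norm_sq, normSq_apply, sub_re, sub_im, mul_re, mul_im, one_re,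
      one_im, conj_re, conj_im]
    ring
  have hψU : MapsTo ψ (ball 0 1) upperHalf := by
    intro ζ hζ
    show 0 < (ψ ζ).im
    rw [hψim]
    have h1 : 0 < ‖1 - ζ‖ := norm_pos_iff.2 (hne ζ hζ)
    have h2 : ‖ζ‖ < 1 := by simpa using hζ
    have h3 : 0 < 1 - ‖ζ‖ ^ 2 := by nlinarith [norm_nonneg ζ]
    positivity
  have hψd : DifferentiableOn ℂ ψ (ball 0 1) := by
    intro ζ hζ
    have := hne ζ hζ
    exact DifferentiableAt.differentiableWithinAt (by fun_prop (disch := assumption))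
  have hcomp : ∀ f : ℂ → ℂ, DifferentiableOn ℂ f upperHalf →
      AnalyticOnNhd ℂ (fun ζ => f (ψ ζ)) (ball 0 1) := fun f hf =>
    (hf.comp hψd hψU).analyticOnNhd isOpen_ball
  have hψ0 : ψ 0 = z₀ := by simp [hψ]
  have hbd : ∀ ζ ∈ ball (0 : ℂ) 1, ‖Q (ψ ζ) / C‖ ≤ 1 := by
    intro ζ hζ
    rw [norm_div, norm_real, Real.norm_of_nonneg hC.le, div_le_one hC]
    exact (hC₂ _ (hψU hζ)).trans ((le_max_right _ _).trans (le_max_right _ _))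
  have hbd2 : ∀ ζ ∈ ball (0 : ℂ) 1, ‖u (ψ ζ) * (Q (ψ ζ) / C)‖ ≤ 1 := by
    intro ζ hζ
    rw [← mul_div_assoc, huQ _ (hψU hζ), norm_div, norm_real, Real.norm_of_nonneg hC.le,
      div_le_one hC]
    exact (hC₁ _ (hψU hζ)).trans ((le_max_left _ _).trans (le_max_right _ _))
  set L := -Real.log ‖Q z₀ / C‖
  have hL : 0 ≤ L := by
    have := hbd 0 (by simp)
    rw [hψ0] at this
    exact neg_nonneg.2 (Real.log_nonpos (norm_nonneg _) this)
  refine ⟨8 * L * (2 * (1 + ‖z₀‖ ^ 2)) / z₀.im, by positivity, fun z hz => ?_⟩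
  have hz' : 0 < z.im := hz
  have hzne : z - conj z₀ ≠ 0 := by
    intro h
    have := congrArg im h
    simp at this
    linarith
  set ζ := (z - z₀) / (z - conj z₀) with hζd
  have hN : 0 < ‖z - conj z₀‖ := norm_pos_iff.2 hzne
  have hid : ‖z - conj z₀‖ ^ 2 - ‖z - z₀‖ ^ 2 = 4 * (z.im * z₀.im) := by
    simp only [← normSq_eq_norm_sq, normSq_apply, sub_re, sub_im, conj_re, conj_im]
    ring
  have hlt : ‖z - z₀‖ < ‖z - conj z₀‖ := by
    refine lt_of_pow_lt_pow_left₀ 2 hN.le ?_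
    have : 0 < z.im * z₀.im := by positivity
    linarith
  have hζn : ‖ζ‖ = ‖z - z₀‖ / ‖z - conj z₀‖ := norm_div _ _
  have hζ1 : ‖ζ‖ < 1 := by rw [hζn, div_lt_one hN]; exact hlt
  have hψζ : ψ ζ = z := by
    have h1 : 1 - ζ = (z₀ - conj z₀) / (z - conj z₀) := by
      rw [hζd]; field_simp; ring
    have h2 : z₀ - conj z₀ ≠ 0 := by
      intro h
      have := congrArg im h
      simp at this
      linarith
    rw [hψ]
    simp only
    rw [h1, hζd]
    field_simp
    ring
  have key := norm_le_exp_of_quotient_disc (q := fun ζ => Q (ψ ζ) / C)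
    (v := fun ζ => u (ψ ζ)) (by
      exact fun z hz => (hcomp Q hQ z hz).div analyticAt_const hC0)
    (hcomp u hud) hbd hbd2 (by simpa [hψ0] using ⟨hQ0, hC.ne'⟩)
    (w := ζ) (by simpa using hζ1)
  simp only [hψζ, hψ0] at key
  refine key.trans (Real.exp_le_exp.2 ?_)
  -- `1/(1 - |ζ|) ≤ 2/(1 - |ζ|²)`, and `1 - |ζ|² = 4 Im z Im z₀ / |z - z̄₀|²`.
  have h1 : 4 / (1 - ‖ζ‖) ≤ 8 * (‖z - conj z₀‖ ^ 2 / (4 * (z.im * z₀.im))) := by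
    rw [← hid]
    have h3 : 1 - ‖ζ‖ = (‖z - conj z₀‖ - ‖z - z₀‖) / ‖z - conj z₀‖ := by
      rw [hζn]; field_simp
    rw [h3, ← mul_div_assoc, div_div_eq_mul_div, div_le_div_iff₀ (by linarith)
      (by nlinarith [norm_nonneg (z - z₀)])]
    have e1 : 0 ≤ ‖z - conj z₀‖ - ‖z - z₀‖ := by linarith
    nlinarith [mul_nonneg (mul_nonneg hN.le e1) e1]
  have h2 : ‖z - conj z₀‖ ^ 2 ≤ 2 * (1 + ‖z₀‖ ^ 2) * (1 + ‖z‖ ^ 2) := by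
    have := norm_sub_le z (conj z₀)
    rw [RCLike.norm_conj] at this
    nlinarith [norm_nonneg z, norm_nonneg z₀, norm_nonneg (z - conj z₀), sq_nonneg (‖z‖ - ‖z₀‖),
      mul_nonneg (sq_nonneg ‖z‖) (sq_nonneg ‖z₀‖)]
  calc 4 / (1 - ‖ζ‖) * L ≤ 8 * (‖z - conj z₀‖ ^ 2 / (4 * (z.im * z₀.im))) * L := by gcongr
    _ ≤ 8 * (2 * (1 + ‖z₀‖ ^ 2) * (1 + ‖z‖ ^ 2) / (4 * (z.im * z₀.im))) * L := by gcongr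
    _ = 1 / 4 * (8 * L * (2 * (1 + ‖z₀‖ ^ 2)) / z₀.im * ((1 + ‖z‖ ^ 2) / z.im)) := by
      field_simp
    _ ≤ 1 * (8 * L * (2 * (1 + ‖z₀‖ ^ 2)) / z₀.im * ((1 + ‖z‖ ^ 2) / z.im)) := by
      gcongr; norm_num
    _ = _ := one_mul _

end DeBranges
end

/-! ### A Phragmén–Lindelöf principle in half-discs. -/

noncomputable section
namespace DeBranges
open Complex Metric Set Filter Topology

/-- Taking `n`-th roots makes a fixed positive factor disappear; this is how the auxiliary factor
`p` below is discarded. -/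
theorem le_of_forall_pow_mul_le {a M c : ℝ} (hM : 1 ≤ M) (hc : 0 < c)
    (h : ∀ n : ℕ, a ^ n * c ≤ M ^ n) : a ≤ M := by
  by_contra! hlt
  have hM0 : 0 < M := by linarith
  have h1 : 1 < a / M := (one_lt_div hM0).2 hlt
  obtain ⟨n, hn⟩ := pow_unbounded_of_one_lt (1 / c) h1
  rw [div_pow, div_lt_div_iff₀ hc (by positivity)] at hn
  linarith [h n]

theorem norm_exp_half_disc (a : ℝ) (R : ℝ) (z : ℂ) :
    ‖exp (a * I * (((R : ℂ) - z)⁻¹ - ((R : ℂ) + z)⁻¹))‖ =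
      Real.exp (-(a * (z.im / normSq (R - z) + z.im / normSq (R + z)))) := by
  rw [norm_exp]
  congr 1
  rw [mul_assoc, re_ofReal_mul, I_mul_re, sub_im, inv_im, inv_im]
  simp only [sub_im, add_im, ofReal_im]
  ring

theorem closure_half_disc_subset (R : ℝ) :
    closure (ball (0 : ℂ) R ∩ upperHalf) ⊆ {z | ‖z‖ ≤ R ∧ 0 ≤ z.im} := by
  refine closure_minimal ?_ ?_
  · rintro z ⟨hz, hz'⟩
    exact ⟨by simpa using (mem_ball_zero_iff.1 hz).le, le_of_lt hz'⟩
  · exact (isClosed_le continuous_norm continuous_const).inter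
      (isClosed_le continuous_const continuous_im)

/-- The sum of Poisson kernels with poles at `±R` equals `1 / Im z` on the half-circle `|z| = R`, so
a multiple of it dominates the permitted growth there and is nonnegative on the closed half-disc off
`±R`. The factor `e` has minus that multiple as the logarithm of its modulus. -/
theorem norm_le_half_disc {U : ℂ → ℂ} {A M R : ℝ} (hU : Continuous U)
    (hUd : DifferentiableOn ℂ U upperHalf) (hA : 0 ≤ A) (hM : 1 ≤ M)
    (hreal : ∀ t : ℝ, ‖U t‖ ≤ M)
    (hgr : ∀ z ∈ upperHalf, ‖U z‖ ≤ Real.exp (A * ((1 + ‖z‖ ^ 2) / z.im))) (hR : 1 ≤ R)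
    {z : ℂ} (hz : z ∈ upperHalf) (hzR : ‖z‖ < R) :
    ‖U z‖ ≤ M * Real.exp (2 * A * R ^ 2 * (z.im / normSq (R - z) + z.im / normSq (R + z))) := by
  have hR0 : 0 < R := by linarith
  have hRc : (R : ℂ) ≠ 0 := by exact_mod_cast hR0.ne'
  -- `A (1 + R²) ≤ a` because `R ≥ 1`.
  set a : ℝ := 2 * A * R ^ 2 with ha
  have ha0 : 0 ≤ a := by positivity
  set e : ℂ → ℂ := fun z => exp (a * I * (((R : ℂ) - z)⁻¹ - ((R : ℂ) + z)⁻¹)) with he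
  set p : ℂ → ℂ := fun z => ((R : ℂ) ^ 2 - z ^ 2) / (2 * R ^ 2) with hp
  set Ω := ball (0 : ℂ) R ∩ upperHalf
  have he1 : ∀ w : ℂ, 0 ≤ w.im → ‖e w‖ ≤ 1 := by
    intro w hw
    rw [he]
    simp only
    rw [norm_exp_half_disc, Real.exp_le_one_iff, neg_nonpos]
    have := normSq_nonneg ((R : ℂ) - w)
    have := normSq_nonneg ((R : ℂ) + w)
    positivity
  have hecont : ∀ w : ℂ, (R : ℂ) - w ≠ 0 → (R : ℂ) + w ≠ 0 → DifferentiableAt ℂ e w := by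
    intro w h1 h2
    fun_prop (disch := assumption)
  have hpcont : Continuous p := by fun_prop
  have hp1 : ∀ w : ℂ, ‖w‖ ≤ R → ‖p w‖ ≤ 1 := by
    intro w hw
    rw [hp]
    simp only
    rw [norm_div, norm_mul, norm_pow, norm_real, Real.norm_of_nonneg hR0.le]
    simp only [Complex.norm_ofNat]
    rw [div_le_one (by positivity)]
    refine (norm_sub_le _ _).trans ?_
    rw [norm_pow, norm_pow, norm_real, Real.norm_of_nonneg hR0.le]
    nlinarith [norm_nonneg w]
  have hΩo : IsOpen Ω := isOpen_ball.inter isOpen_upperHalf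
  have hΩne : ∀ w ∈ upperHalf, (R : ℂ) - w ≠ 0 ∧ (R : ℂ) + w ≠ 0 := by
    intro w hw
    have hw' : 0 < w.im := hw
    constructor <;> intro h <;> have := congrArg im h <;> simp at this <;> linarith
  -- The function `e` is singular at `±R`, but it is bounded on the rest of the closed half-disc and
  -- `p` vanishes there, so the product is continuous up to the closure and the maximum principle
  -- applies. The power `n` serves to remove `p` at the end.
  have hbound : ∀ n : ℕ, 1 ≤ n → ∀ w ∈ closure Ω, ‖(U w * e w) ^ n * p w‖ ≤ M ^ n := by
    intro n hn
    have hdc : DiffContOnCl ℂ (fun w => (U w * e w) ^ n * p w) Ω := by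
      constructor
      · intro w hw
        have h1 := hΩne w hw.2
        have h2 := hecont w h1.1 h1.2
        have h3 : DifferentiableAt ℂ U w := hUd.differentiableAt (isOpen_upperHalf.mem_nhds hw.2)
        have h4 : DifferentiableAt ℂ p w := by fun_prop
        exact (((h3.mul h2).pow n).mul h4).differentiableWithinAt
      · intro w hw
        have hw' := closure_half_disc_subset R hw
        by_cases h : (R : ℂ) - w ≠ 0 ∧ (R : ℂ) + w ≠ 0
        · exact (((hU.continuousAt.mul (hecont w h.1 h.2).continuousAt).pow n).mul
            hpcont.continuousAt).continuousWithinAt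
        · have hpw : p w = 0 := by
            have : ((R : ℂ) - w) * (R + w) = 0 := by
              rw [mul_eq_zero]; tauto
            rw [hp]
            simp only
            rw [show (R : ℂ) ^ 2 - w ^ 2 = (R - w) * (R + w) by ring, this, zero_div]
          have : Tendsto (fun w => ‖U w‖ ^ n * ‖p w‖) (𝓝[closure Ω] w) (𝓝 0) := by
            have h1 : ContinuousAt (fun w => ‖U w‖ ^ n * ‖p w‖) w := by fun_prop
            have h2 := h1.tendsto
            rw [hpw, norm_zero, mul_zero] at h2
            exact h2.mono_left nhdsWithin_le_nhds
          show Tendsto _ _ _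
          simp only [hpw, mul_zero]
          refine squeeze_zero_norm' ?_ this
          filter_upwards [self_mem_nhdsWithin] with v hv
          have hv' := closure_half_disc_subset R hv
          rw [norm_mul, norm_pow, norm_mul]
          gcongr
          exact mul_le_of_le_one_right (norm_nonneg _) (he1 v hv'.2)
    refine fun w hw => norm_le_of_forall_mem_frontier_norm_le
      (isBounded_ball.subset inter_subset_left) hdc ?_ hw
    intro v hv
    have hv' := closure_half_disc_subset R (frontier_subset_closure hv)
    have hvn : v ∉ Ω := by
      rw [hΩo.frontier_eq] at hv; exact hv.2
    have hM0 : 0 ≤ M := by linarith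
    have key : ‖U v * e v‖ ≤ M := by
      by_cases him : v.im = 0
      · have hvr : v = (v.re : ℂ) := Complex.ext rfl (by simpa using him)
        rw [norm_mul]
        have h1 := hreal v.re
        rw [← hvr] at h1
        exact (mul_le_mul h1 (he1 v hv'.2) (norm_nonneg _) hM0).trans (mul_one M).le
      · have hvim : 0 < v.im := lt_of_le_of_ne hv'.2 (Ne.symm him)
        have hvR : ‖v‖ = R := by
          by_contra hne
          exact hvn ⟨by simpa using lt_of_le_of_ne hv'.1 hne, hvim⟩
        have hsq : v.re * v.re + v.im * v.im = R ^ 2 := by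
          rw [← normSq_apply, normSq_eq_norm_sq, hvR]
        have hpm := hΩne v hvim
        -- For `|v| = R` the two squared distances have sum `4R²` and product `4R² (Im v)²`.
        have hh : v.im / normSq (R - v) + v.im / normSq (R + v) = 1 / v.im := by
          have e1 := normSq_pos.2 hpm.1
          have e2 := normSq_pos.2 hpm.2
          have e3 : normSq ((R : ℂ) - v) + normSq ((R : ℂ) + v) = 4 * R ^ 2 := by
            simp only [normSq_apply, sub_re, sub_im, add_re, add_im, ofReal_re, ofReal_im]
            nlinarith
          have e4 : normSq ((R : ℂ) - v) * normSq ((R : ℂ) + v) = 4 * R ^ 2 * v.im ^ 2 := by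
            have a1 : normSq ((R : ℂ) - v) = 2 * R ^ 2 - 2 * R * v.re := by
              simp only [normSq_apply, sub_re, sub_im, ofReal_re, ofReal_im]
              nlinarith
            have a2 : normSq ((R : ℂ) + v) = 2 * R ^ 2 + 2 * R * v.re := by
              simp only [normSq_apply, add_re, add_im, ofReal_re, ofReal_im]
              nlinarith
            rw [a1, a2]
            linear_combination (-4 * R ^ 2) * hsq
          rw [div_add_div _ _ e1.ne' e2.ne', e4, div_eq_div_iff (by positivity) hvim.ne']
          linear_combination v.im ^ 2 * e3
        rw [norm_mul]
        have h1 := hgr v hvim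
        have h2 : ‖e v‖ = Real.exp (-(a * (1 / v.im))) := by
          rw [he]; simp only; rw [norm_exp_half_disc, hh]
        rw [h2]
        refine le_trans (mul_le_mul_of_nonneg_right h1 (Real.exp_pos _).le) ?_
        rw [← Real.exp_add]
        refine le_trans (Real.exp_le_one_iff.2 ?_) hM
        rw [hvR, ha]
        have : A * ((1 + R ^ 2) / v.im) + -(2 * A * R ^ 2 * (1 / v.im)) =
          -(A * ((R ^ 2 - 1) / v.im)) := by field_simp; ring
        rw [this, neg_nonpos]
        have : 0 ≤ R ^ 2 - 1 := by nlinarith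
        positivity
    rw [norm_mul, norm_pow]
    calc ‖U v * e v‖ ^ n * ‖p v‖ ≤ M ^ n * 1 := by
          gcongr
          exact hp1 v hv'.1
      _ = M ^ n := mul_one _
  have hzΩ : z ∈ closure Ω := subset_closure ⟨by simpa using hzR, hz⟩
  have hpz : 0 < ‖p z‖ := by
    rw [norm_pos_iff, hp]
    simp only
    refine div_ne_zero ?_ (mul_ne_zero two_ne_zero (pow_ne_zero _ hRc))
    rw [show (R : ℂ) ^ 2 - z ^ 2 = (R - z) * (R + z) by ring]
    exact mul_ne_zero (hΩne z hz).1 (hΩne z hz).2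
  have hfin : ‖U z * e z‖ ≤ M := by
    refine le_of_forall_pow_mul_le hM hpz fun n => ?_
    rcases Nat.eq_zero_or_pos n with rfl | hn
    · simpa using hp1 z hzR.le
    · have := hbound n hn z hzΩ
      rwa [norm_mul, norm_pow] at this
  rw [norm_mul, he] at hfin
  simp only at hfin
  rw [norm_exp_half_disc, Real.exp_neg] at hfin
  rwa [← div_eq_mul_inv, div_le_iff₀ (Real.exp_pos _)] at hfin

/-- A Phragmén-Lindelöf principle: a function bounded on the real line whose logarithm is at most
`A (1 + |z|²) / Im z` has exponential type at most `4 A`. -/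
theorem norm_le_exp_im_of_growth {U : ℂ → ℂ} {A M : ℝ} (hU : Continuous U)
    (hUd : DifferentiableOn ℂ U upperHalf) (hA : 0 ≤ A) (hM : 1 ≤ M)
    (hreal : ∀ t : ℝ, ‖U t‖ ≤ M)
    (hgr : ∀ z ∈ upperHalf, ‖U z‖ ≤ Real.exp (A * ((1 + ‖z‖ ^ 2) / z.im)))
    {z : ℂ} (hz : 0 ≤ z.im) : ‖U z‖ ≤ M * Real.exp (4 * A * z.im) := by
  rcases hz.eq_or_lt with h0 | hz
  · have hzr : z = (z.re : ℂ) := Complex.ext rfl (by simpa using h0.symm)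
    have := hreal z.re
    rw [← hzr] at this
    simpa [← h0] using this
  -- As `R → ∞` each Poisson term times `R²` tends to `Im z`; the two of them turn `2A` into the
  -- type `4A`.
  have hlim : ∀ s : ℂ, Tendsto (fun R : ℝ => R ^ 2 * (z.im / normSq (R + s))) atTop (𝓝 z.im) := by
    intro s
    have h1 : Tendsto (fun r : ℝ => z.im / normSq (1 + r * s)) (𝓝 0) (𝓝 z.im) := by
      have : ContinuousAt (fun r : ℝ => z.im / normSq (1 + r * s)) 0 := by
        refine ContinuousAt.div continuousAt_const ?_ (by simp)
        exact (continuous_normSq.comp (by fun_prop)).continuousAt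
      simpa [ContinuousAt] using this
    refine (h1.comp tendsto_inv_atTop_zero).congr' ?_
    filter_upwards [eventually_gt_atTop 0] with R hR
    have : (R : ℂ) + s = R * (1 + (R⁻¹ : ℝ) * s) := by
      have : (R : ℂ) ≠ 0 := by exact_mod_cast hR.ne'
      push_cast
      field_simp
    simp only [Function.comp_apply]
    rw [this, normSq_mul, normSq_ofReal]
    field_simp
  have hl2 : Tendsto (fun R : ℝ => M * Real.exp (2 * A * R ^ 2 *
      (z.im / normSq (R - z) + z.im / normSq (R + z)))) atTop
      (𝓝 (M * Real.exp (4 * A * z.im))) := by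
    refine Tendsto.const_mul _ ((Real.continuous_exp.tendsto _).comp ?_)
    have := ((hlim (-z)).add (hlim z)).const_mul (2 * A)
    refine (this.congr fun R => ?_).trans_eq (by ring_nf)
    rw [← sub_eq_add_neg]
    ring
  refine ge_of_tendsto hl2 ?_
  filter_upwards [eventually_ge_atTop 1, eventually_gt_atTop ‖z‖] with R h1 h2
  exact norm_le_half_disc hU hUd hA hM hreal hgr h1 hz h2

end DeBranges
end

/-! ### Contour integration and the Cauchy integral over the real line. -/

noncomputable section
namespace DeBranges
open Complex Metric Set Filter Topology MeasureTheory

/-- The Cauchy integral `∫ φ(t) / (t - z) dt` over the real line, without the factor `1 / (2πi)`. -/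
def cauchyInt (φ : ℝ → ℂ) (z : ℂ) : ℂ := ∫ t : ℝ, φ t / ((t : ℂ) - z)

theorem ofReal_sub_ne_zero {z : ℂ} (hz : z.im ≠ 0) (t : ℝ) : (t : ℂ) - z ≠ 0 := by
  intro h
  have := congrArg im h
  simp at this
  exact hz this

theorem abs_im_le_norm_ofReal_sub (z : ℂ) (t : ℝ) : |z.im| ≤ ‖(t : ℂ) - z‖ := by
  have := abs_im_le_norm ((t : ℂ) - z)
  simpa using this

/-- The integral over the real line of a function analytic in the upper half-plane that is
`O(|z|⁻²)` at infinity vanishes. -/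
theorem integral_real_eq_zero {G : ℂ → ℂ} {K R₀ : ℝ} (hc : ContinuousOn G {z | 0 ≤ z.im})
    (hd : DifferentiableOn ℂ G upperHalf) (hi : Integrable fun t : ℝ => G t)
    (hb : ∀ z : ℂ, 0 ≤ z.im → R₀ ≤ ‖z‖ → ‖G z‖ ≤ K / ‖z‖ ^ 2) :
    ∫ t : ℝ, G t = 0 := by
  have hlim := intervalIntegral_tendsto_integral hi tendsto_neg_atTop_atBot tendsto_id
  refine tendsto_nhds_unique hlim ?_
  have hK : Tendsto (fun R : ℝ => 4 * |K| / R) atTop (𝓝 0) := tendsto_const_nhds.div_atTop tendsto_id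
  refine squeeze_zero_norm' ?_ hK
  filter_upwards [eventually_ge_atTop R₀, eventually_gt_atTop 0] with R hR hR0
  -- On the rectangle `[-R, R] × [0, R]` the three nonreal sides have total length `4R` and lie at
  -- distance at least `R` from the origin, so they contribute `O(1/R)`.
  have hrect := integral_boundary_rect_eq_zero_of_continuousOn_of_differentiableOn G
    (-R : ℂ) (R + R * I) (by
      refine hc.mono fun z hz => ?_
      have := hz.2
      simp [hR0.le] at this
      exact this.1) (by
      refine hd.mono fun z hz => ?_
      have := hz.2
      simp [hR0.le] at this
      exact this.1)
  simp only [neg_re, ofReal_re, add_re, mul_re, I_re, mul_zero, ofReal_im, I_im, mul_one, sub_zero,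
    add_zero, neg_im, neg_zero, add_im, mul_im, zero_add, ofReal_zero, zero_mul, ofReal_neg] at hrect
  have hbd : ∀ z : ℂ, 0 ≤ z.im → R ≤ ‖z‖ → ‖G z‖ ≤ |K| / R ^ 2 := by
    intro z hz hRz
    refine (hb z hz (hR.trans hRz)).trans ?_
    gcongr
    exact le_abs_self K
  have h1 : ‖∫ x : ℝ in -R..R, G (x + R * I)‖ ≤ |K| / R ^ 2 * |R - -R| := by
    refine intervalIntegral.norm_integral_le_of_norm_le_const fun x _ => hbd _ (by simp [hR0.le]) ?_
    have := abs_im_le_norm ((x : ℂ) + R * I)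
    simp [abs_of_pos hR0] at this
    exact this
  have h2 : ‖∫ y : ℝ in (0 : ℝ)..R, G (R + y * I)‖ ≤ |K| / R ^ 2 * |R - 0| := by
    refine intervalIntegral.norm_integral_le_of_norm_le_const fun x hx => hbd _ ?_ ?_
    · rw [uIoc_of_le hR0.le] at hx
      simp [hx.1.le]
    · have := abs_re_le_norm ((R : ℂ) + x * I)
      simp [abs_of_pos hR0] at this
      exact this
  have h3 : ‖∫ y : ℝ in (0 : ℝ)..R, G (-R + y * I)‖ ≤ |K| / R ^ 2 * |R - 0| := by
    refine intervalIntegral.norm_integral_le_of_norm_le_const fun x hx => hbd _ ?_ ?_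
    · rw [uIoc_of_le hR0.le] at hx
      simp [hx.1.le]
    · have := abs_re_le_norm (-(R : ℂ) + x * I)
      simp [abs_of_pos hR0] at this
      exact this
  have hsplit : (∫ x : ℝ in -R..R, G x) = (∫ x : ℝ in -R..R, G (x + R * I)) -
      I • (∫ y : ℝ in (0 : ℝ)..R, G (R + y * I)) + I • ∫ y : ℝ in (0 : ℝ)..R, G (-R + y * I) := by
    linear_combination hrect
  simp only [id]
  rw [hsplit]
  have hRR : |R - -R| = 2 * R := by rw [abs_of_pos (by linarith)]; ring
  rw [hRR] at h1
  rw [sub_zero, abs_of_pos hR0] at h2 h3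
  calc _ ≤ _ := norm_add_le _ _
    _ ≤ _ := add_le_add_left (norm_sub_le _ _) _
    _ ≤ |K| / R ^ 2 * (2 * R) + |K| / R ^ 2 * R + |K| / R ^ 2 * R := by
      rw [norm_smul, norm_smul, norm_I, one_mul, one_mul]
      gcongr
    _ = 4 * |K| / R := by field_simp; ring

theorem normSq_ofReal_sub (z : ℂ) (t : ℝ) :
    normSq ((t : ℂ) - z) = (t - z.re) ^ 2 + z.im ^ 2 := by
  simp [normSq_apply]; ring

theorem integrable_inv_normSq {z : ℂ} (hz : z.im ≠ 0) :
    Integrable fun t : ℝ => (normSq ((t : ℂ) - z))⁻¹ := by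
  have h := ((integrable_inv_one_add_sq.comp_div hz).comp_sub_right z.re).const_mul (z.im ^ 2)⁻¹
  refine h.congr (Eventually.of_forall fun t => ?_)
  simp only
  rw [normSq_ofReal_sub]
  have : (0:ℝ) < (t - z.re) ^ 2 + z.im ^ 2 := by positivity
  have : (0:ℝ) < 1 + ((t - z.re) / z.im) ^ 2 := by positivity
  field_simp
  ring

theorem integral_inv_normSq {z : ℂ} (hz : 0 < z.im) :
    ∫ t : ℝ, (normSq ((t : ℂ) - z))⁻¹ = Real.pi / z.im := by
  have h1 : ∀ t : ℝ, (normSq ((t : ℂ) - z))⁻¹ =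
      (fun x : ℝ => (z.im ^ 2)⁻¹ * (1 + (x / z.im) ^ 2)⁻¹) (t - z.re) := by
    intro t
    simp only
    rw [normSq_ofReal_sub]
    have : (0:ℝ) < (t - z.re) ^ 2 + z.im ^ 2 := by positivity
    have : (0:ℝ) < 1 + ((t - z.re) / z.im) ^ 2 := by positivity
    field_simp
    ring
  simp_rw [h1]
  rw [integral_sub_right_eq_self (fun x : ℝ => (z.im ^ 2)⁻¹ * (1 + (x / z.im) ^ 2)⁻¹),
    integral_const_mul, Measure.integral_comp_div (fun x : ℝ => (1 + x ^ 2)⁻¹),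
    integral_univ_inv_one_add_sq, abs_of_pos hz, smul_eq_mul]
  field_simp

theorem memLp_inv_ofReal_sub {z : ℂ} (hz : z.im ≠ 0) :
    MemLp (fun t : ℝ => ((t : ℂ) - z)⁻¹) 2 := by
  have hm : AEStronglyMeasurable (fun t : ℝ => ((t : ℂ) - z)⁻¹) volume :=
    (Continuous.inv₀ (by fun_prop) (ofReal_sub_ne_zero hz)).aestronglyMeasurable
  rw [memLp_two_iff_integrable_sq_norm hm]
  refine (integrable_inv_normSq hz).congr (Eventually.of_forall fun t => ?_)
  simp only
  rw [norm_inv, inv_pow, normSq_eq_norm_sq]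

theorem integrable_div_ofReal_sub {φ : ℝ → ℂ} (hφ : MemLp φ 2) {z : ℂ} (hz : z.im ≠ 0) :
    Integrable fun t : ℝ => φ t / ((t : ℂ) - z) := by
  simpa [div_eq_mul_inv] using! hφ.integrable_mul (memLp_inv_ofReal_sub hz)

theorem differentiableAt_cauchyInt {φ : ℝ → ℂ} (hφ : MemLp φ 2) {z : ℂ} (hz : z.im ≠ 0) :
    DifferentiableAt ℂ (cauchyInt φ) z := by
  have hz' : 0 < |z.im| := abs_pos.2 hz
  -- For `w` within `|Im z|/2` of `z` this gives `|t - w|² ≥ |t - z|²/4 ≥ |Im z| |t - z|/4`, whence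
  -- the dominating function used to differentiate under the integral.
  have hnear : ∀ w ∈ ball z (|z.im| / 2), ∀ t : ℝ, ‖(t : ℂ) - z‖ / 2 ≤ ‖(t : ℂ) - w‖ := by
    intro w hw t
    have h1 : ‖w - z‖ < |z.im| / 2 := by simpa [dist_eq_norm] using hw
    have h2 := abs_im_le_norm_ofReal_sub z t
    have h3 : ‖(t : ℂ) - z‖ ≤ ‖(t : ℂ) - w‖ + ‖w - z‖ := by
      rw [show (t : ℂ) - z = (t - w) + (w - z) by ring]; exact norm_add_le _ _
    linarith
  have hne : ∀ w ∈ ball z (|z.im| / 2), ∀ t : ℝ, (t : ℂ) - w ≠ 0 := by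
    intro w hw t
    have h1 := hnear w hw t
    have h2 := abs_im_le_norm_ofReal_sub z t
    exact norm_pos_iff.1 (by linarith)
  have hb : MemLp (fun t : ℝ => ((t : ℂ) - z)⁻¹) 2 := memLp_inv_ofReal_sub hz
  have h := hasDerivAt_integral_of_dominated_loc_of_deriv_le
    (F := fun (w : ℂ) (t : ℝ) => φ t / ((t : ℂ) - w))
    (F' := fun (w : ℂ) (t : ℝ) => φ t / ((t : ℂ) - w) ^ 2) (μ := volume)
    (x₀ := z) (s := ball z (|z.im| / 2)) (ball_mem_nhds _ (by positivity))
    (bound := fun t => 4 / |z.im| * ‖φ t / ((t : ℂ) - z)‖) ?_ (integrable_div_ofReal_sub hφ hz) ?_ ?_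
    ?_ ?_
  · exact h.2.differentiableAt
  · filter_upwards [ball_mem_nhds z (half_pos hz')] with w hw
    exact hφ.1.div₀ (by fun_prop : Continuous fun t : ℝ => (t : ℂ) - w).aestronglyMeasurable
  · exact hφ.1.div₀ (by fun_prop : Continuous fun t : ℝ => ((t : ℂ) - z) ^ 2).aestronglyMeasurable
  · refine Eventually.of_forall fun t w hw => ?_
    have h1 := hnear w hw t
    have h2 := abs_im_le_norm_ofReal_sub z t
    have h3 : 0 < ‖(t : ℂ) - z‖ := by linarith
    rw [norm_div, norm_div, norm_pow]
    have h4 : |z.im| * ‖(t : ℂ) - z‖ / 4 ≤ ‖(t : ℂ) - w‖ ^ 2 := by nlinarith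
    calc ‖φ t‖ / ‖(t : ℂ) - w‖ ^ 2 ≤ ‖φ t‖ / (|z.im| * ‖(t : ℂ) - z‖ / 4) := by gcongr
      _ = _ := by field_simp
  · exact (integrable_div_ofReal_sub hφ hz).norm.const_mul _
  · refine Eventually.of_forall fun t w hw => ?_
    have h1 := hne w hw t
    have h2 : HasDerivAt (fun x : ℂ => (t : ℂ) - x) (-1) w := by
      simpa using (hasDerivAt_id w).const_sub (t : ℂ)
    have := (h2.inv h1).const_mul (φ t)
    convert! this using 1
    field_simp

end DeBranges
end

/-! ### Cauchy's formula for bounded functions. -/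

noncomputable section
namespace DeBranges
open Complex Metric Set Filter Topology MeasureTheory

/-- The regularizing factor `1/(1 - iεw)` is bounded by 1 on the closed upper half-plane, decays
like `1/(ε|w|)` and tends to 1 as `ε → 0`. It supplies the decay that a bounded function lacks for
contour integration. -/
theorem one_le_norm_one_sub_mul {ε : ℝ} (hε : 0 ≤ ε) {w : ℂ} (hw : 0 ≤ w.im) :
    1 ≤ ‖1 - ε * I * w‖ := by
  have h := re_le_norm (1 - ε * I * w)
  have : (1 - ε * I * w).re = 1 + ε * w.im := by simp
  rw [this] at h
  have := mul_nonneg hε hw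
  linarith

theorem mul_norm_le_norm_one_sub_mul {ε : ℝ} (hε : 0 ≤ ε) {w : ℂ} (hw : 0 ≤ w.im) :
    ε * ‖w‖ ≤ ‖1 - ε * I * w‖ := by
  refine le_of_sq_le_sq ?_ (norm_nonneg _)
  rw [mul_pow, ← normSq_eq_norm_sq, ← normSq_eq_norm_sq]
  simp [normSq_apply]
  have := mul_nonneg hε hw
  nlinarith

theorem one_sub_mul_ne_zero {ε : ℝ} (hε : 0 ≤ ε) {w : ℂ} (hw : 0 ≤ w.im) :
    1 - ε * I * w ≠ 0 :=
  norm_pos_iff.1 (lt_of_lt_of_le one_pos (one_le_norm_one_sub_mul hε hw))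

theorem tendsto_integral_regularized {φ : ℝ → ℂ} {z : ℂ}
    (hi : Integrable fun t : ℝ => φ t / ((t : ℂ) - z)) :
    Tendsto (fun ε : ℝ => ∫ t : ℝ, φ t / (1 - ε * I * t) / ((t : ℂ) - z)) (𝓝[>] 0)
      (𝓝 (cauchyInt φ z)) := by
  have hre : ∀ (ε : ℝ) (t : ℝ), φ t / (1 - ε * I * t) / ((t : ℂ) - z) =
      φ t / ((t : ℂ) - z) * (1 - ε * I * t)⁻¹ := fun ε t => by
    rw [div_eq_mul_inv, div_eq_mul_inv, div_eq_mul_inv]; ring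
  simp_rw [hre]
  refine tendsto_integral_filter_of_dominated_convergence
    (fun t => ‖φ t / ((t : ℂ) - z)‖) ?_ ?_ hi.norm ?_
  · filter_upwards [self_mem_nhdsWithin] with ε hε
    exact hi.1.mul (Continuous.aestronglyMeasurable (Continuous.inv₀ (by fun_prop)
      fun t => one_sub_mul_ne_zero (le_of_lt hε) (by simp)))
  · filter_upwards [self_mem_nhdsWithin] with ε hε
    refine Eventually.of_forall fun t => ?_
    rw [norm_mul, norm_inv]
    exact mul_le_of_le_one_right (norm_nonneg _)
      (inv_le_one_of_one_le₀ (one_le_norm_one_sub_mul (le_of_lt hε) (by simp)))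
  · refine Eventually.of_forall fun t => ?_
    have : ContinuousAt (fun ε : ℝ => φ t / ((t : ℂ) - z) * (1 - ε * I * t)⁻¹) 0 := by
      refine continuousAt_const.mul (ContinuousAt.inv₀ (by fun_prop) (by simp))
    have h := this.tendsto.mono_left (nhdsWithin_le_nhds (s := Ioi 0))
    simpa using h

/-- The model case of Cauchy's formula: `(z - z̄)/(w - z̄)` equals 1 at `w = z`, and the integrand
is `2i` times the Poisson kernel. -/
theorem integral_conj_kernel {z : ℂ} (hz : 0 < z.im) :
    ∫ t : ℝ, (z - conj z) / ((t : ℂ) - conj z) / ((t : ℂ) - z) = 2 * Real.pi * I := by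
  have h : ∀ t : ℝ, (z - conj z) / ((t : ℂ) - conj z) / ((t : ℂ) - z) =
      (2 * z.im * I) * (((normSq ((t : ℂ) - z))⁻¹ : ℝ) : ℂ) := by
    intro t
    have e1 : (((normSq ((t : ℂ) - z))⁻¹ : ℝ) : ℂ) = (((t : ℂ) - conj z) * ((t : ℂ) - z))⁻¹ := by
      rw [ofReal_inv, normSq_eq_conj_mul_self, map_sub, conj_ofReal]
    rw [e1, div_div, sub_conj, div_eq_mul_inv]
    push_cast
    ring
  simp_rw [h]
  rw [integral_const_mul, integral_complex_ofReal, integral_inv_normSq hz]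
  have : (z.im : ℂ) ≠ 0 := by exact_mod_cast hz.ne'
  push_cast
  field_simp

theorem integrable_conj_kernel {z : ℂ} (hz : 0 < z.im) :
    Integrable fun t : ℝ => (z - conj z) / ((t : ℂ) - conj z) / ((t : ℂ) - z) := by
  have h2 : (conj z).im ≠ 0 := by simpa using hz.ne'
  have := ((memLp_inv_ofReal_sub h2).integrable_mul (memLp_inv_ofReal_sub hz.ne')).const_mul
    (z - conj z)
  refine this.congr (Eventually.of_forall fun t => ?_)
  simp only [Pi.mul_apply, div_eq_mul_inv]
  ring

theorem integrable_regularized {φ : ℝ → ℂ} {z : ℂ} {ε : ℝ} (hε : 0 ≤ ε)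
    (hi : Integrable fun t : ℝ => φ t / ((t : ℂ) - z)) :
    Integrable fun t : ℝ => φ t / (1 - ε * I * t) / ((t : ℂ) - z) := by
  refine hi.norm.mono' ?_ (Eventually.of_forall fun t => ?_)
  · have : AEStronglyMeasurable (fun t : ℝ => φ t / ((t : ℂ) - z) * (1 - ε * I * t)⁻¹) volume :=
      hi.1.mul (Continuous.aestronglyMeasurable (Continuous.inv₀ (by fun_prop)
        fun t => one_sub_mul_ne_zero hε (by simp)))
    refine this.congr (Eventually.of_forall fun t => ?_)
    simp only [div_eq_mul_inv]; ring
  · rw [norm_div, norm_div, norm_div]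
    gcongr
    exact div_le_self (norm_nonneg _) (one_le_norm_one_sub_mul hε (by simp))

/-- Cauchy's formula in the upper half-plane for bounded functions. -/
theorem cauchyInt_eq_of_bounded {g : ℂ → ℂ} {M : ℝ} (hg : Continuous g)
    (hgd : DifferentiableOn ℂ g upperHalf) (hM : ∀ z : ℂ, 0 ≤ z.im → ‖g z‖ ≤ M) {z : ℂ}
    (hz : 0 < z.im) (hi : Integrable fun t : ℝ => g t / ((t : ℂ) - z)) :
    cauchyInt (fun t => g t) z = 2 * Real.pi * I * g z := by
  have hM0 : 0 ≤ M := (norm_nonneg _).trans (hM z hz.le)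
  have hcont : Tendsto (fun ε : ℝ => g z / (1 - ε * I * z) * (2 * Real.pi * I)) (𝓝[>] 0)
      (𝓝 (2 * Real.pi * I * g z)) := by
    have : ContinuousAt (fun ε : ℝ => g z / (1 - ε * I * z) * (2 * Real.pi * I)) 0 := by
      refine (ContinuousAt.div continuousAt_const (by fun_prop) (by simp)).mul continuousAt_const
    have h := this.tendsto.mono_left (nhdsWithin_le_nhds (s := Ioi 0))
    simpa [mul_comm] using h
  refine tendsto_nhds_unique (tendsto_integral_regularized hi) (hcont.congr' ?_)
  filter_upwards [self_mem_nhdsWithin] with ε hε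
  have hε' : 0 < ε := hε
  set c := g z / (1 - ε * I * z) with hc
  -- Subtracting a multiple of the model function makes `N` vanish at `z`. Thus `N(w)/(w - z)` is
  -- analytic and `O(|w|⁻²)`, its integral is zero, and only the model integral remains.
  set N : ℂ → ℂ := fun w => g w / (1 - ε * I * w) - c * ((z - conj z) / (w - conj z)) with hN
  have hne : ∀ w : ℂ, 0 ≤ w.im → w - conj z ≠ 0 := by
    intro w hw h
    have := congrArg im h
    simp at this
    linarith
  have hNz : N z = 0 := by
    rw [hN]; simp only
    rw [div_self (hne z hz.le), mul_one, sub_self]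
  have hNc : ContinuousOn N {w | 0 ≤ w.im} := by
    refine (hg.continuousOn.div (by fun_prop) fun w hw => one_sub_mul_ne_zero hε'.le hw).sub
      (continuousOn_const.mul (continuousOn_const.div (by fun_prop) fun w hw => hne w hw))
  have hNd : DifferentiableOn ℂ N upperHalf := by
    refine (hgd.div (by fun_prop) fun w hw => one_sub_mul_ne_zero hε'.le (le_of_lt hw)).sub
      (DifferentiableOn.const_mul ((differentiableOn_const _).div (by fun_prop)
        fun w hw => hne w (le_of_lt hw)) _)
  have hUz : upperHalf ∈ 𝓝 z := isOpen_upperHalf.mem_nhds hz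
  have hsub : upperHalf ⊆ {w : ℂ | 0 ≤ w.im} := fun w (hw : 0 < w.im) => le_of_lt hw
  have hGv : ∀ w, w ≠ z → dslope N z w = N w / (w - z) := by
    intro w hw
    rw [dslope_of_ne _ hw, slope_def_field, hNz, sub_zero]
  have hGr : ∀ t : ℝ, dslope N z t = g t / (1 - ε * I * t) / ((t : ℂ) - z) -
      c * ((z - conj z) / ((t : ℂ) - conj z) / ((t : ℂ) - z)) := by
    intro t
    rw [hGv _ (sub_ne_zero.1 (ofReal_sub_ne_zero hz.ne' t)), hN]
    simp only
    ring
  have hi1 := integrable_regularized hε'.le hi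
  have hi2 := (integrable_conj_kernel hz).const_mul c
  have key := integral_real_eq_zero (G := dslope N z)
    (K := 2 * (M / ε + 2 * ‖c‖ * ‖z - conj z‖)) (R₀ := 2 * ‖z‖ + 1)
    ((continuousOn_dslope (mem_of_superset hUz hsub)).2
      ⟨hNc, hNd.differentiableAt hUz⟩)
    ((Complex.differentiableOn_dslope hUz).2 hNd) (by
      simp_rw [hGr]; exact hi1.sub hi2) (by
      intro w hw hwz
      have hw0 : 0 < ‖w‖ := by linarith [norm_nonneg z]
      have hwne : w ≠ z := by
        rintro rfl
        linarith [norm_nonneg w]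
      rw [hGv w hwne, norm_div]
      have h1 : ‖w‖ / 2 ≤ ‖w - z‖ := by
        have := norm_sub_norm_le w z
        linarith
      have h2 : ‖w‖ / 2 ≤ ‖w - conj z‖ := by
        have := norm_sub_norm_le w (conj z)
        rw [RCLike.norm_conj] at this
        linarith
      have h3 : ‖N w‖ ≤ (M / ε + 2 * ‖c‖ * ‖z - conj z‖) / ‖w‖ := by
        rw [hN]; simp only
        refine (norm_sub_le _ _).trans ?_
        rw [norm_div (g w), norm_mul c, norm_div (z - conj z)]
        have h4 := mul_norm_le_norm_one_sub_mul hε'.le hw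
        calc _ ≤ M / (ε * ‖w‖) + ‖c‖ * (‖z - conj z‖ / (‖w‖ / 2)) := by
              gcongr
              exact hM w hw
          _ = _ := by field_simp
      calc ‖N w‖ / ‖w - z‖ ≤ (M / ε + 2 * ‖c‖ * ‖z - conj z‖) / ‖w‖ / (‖w‖ / 2) := by gcongr
        _ = _ := by field_simp)
  simp_rw [hGr] at key
  rw [integral_sub hi1 hi2, integral_const_mul, integral_conj_kernel hz, sub_eq_zero] at key
  exact key.symm

theorem cauchyInt_eq_zero_of_bounded {g : ℂ → ℂ} {M : ℝ} (hg : Continuous g)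
    (hgd : DifferentiableOn ℂ g upperHalf) (hM : ∀ z : ℂ, 0 ≤ z.im → ‖g z‖ ≤ M) {z : ℂ}
    (hz : z.im < 0) (hi : Integrable fun t : ℝ => g t / ((t : ℂ) - z)) :
    cauchyInt (fun t => g t) z = 0 := by
  have hM0 : 0 ≤ M := (norm_nonneg _).trans (hM 0 (by simp))
  refine tendsto_nhds_unique (tendsto_integral_regularized hi) (tendsto_const_nhds.congr' ?_)
  filter_upwards [self_mem_nhdsWithin] with ε hε
  have hε' : 0 < ε := hε
  have hne : ∀ w : ℂ, 0 ≤ w.im → w - z ≠ 0 := by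
    intro w hw h
    have := congrArg im h
    simp at this
    linarith
  refine (integral_real_eq_zero (G := fun w => g w / (1 - ε * I * w) / (w - z))
    (K := 2 * (M / ε)) (R₀ := 2 * ‖z‖ + 1) ?_ ?_ (integrable_regularized hε'.le hi) ?_).symm
  · exact (hg.continuousOn.div (by fun_prop) fun w hw => one_sub_mul_ne_zero hε'.le hw).div
      (by fun_prop) fun w hw => hne w hw
  · exact (hgd.div (by fun_prop) fun w hw => one_sub_mul_ne_zero hε'.le (le_of_lt hw)).div
      (by fun_prop) fun w hw => hne w (le_of_lt hw)
  · intro w hw hwz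
    have hw0 : 0 < ‖w‖ := by linarith [norm_nonneg z]
    have h1 : ‖w‖ / 2 ≤ ‖w - z‖ := by
      have := norm_sub_norm_le w z
      linarith
    have h4 := mul_norm_le_norm_one_sub_mul hε'.le hw
    rw [norm_div, norm_div]
    calc _ ≤ M / (ε * ‖w‖) / (‖w‖ / 2) := by
          gcongr
          exact hM w hw
      _ = _ := by field_simp

/-! ### Moving averages. -/

/-- The moving average `∫₀ʰ k(s) u(z + s) ds`. -/
def movingAverage (k : ℝ → ℂ) (h : ℝ) (u : ℂ → ℂ) (z : ℂ) : ℂ :=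
  ∫ s in (0 : ℝ)..h, k s * u (z + s)

theorem continuous_movingAverage {k : ℝ → ℂ} {h : ℝ} {u : ℂ → ℂ} (hk : Continuous k)
    (hu : Continuous u) : Continuous (movingAverage k h u) := by
  refine intervalIntegral.continuous_parametric_intervalIntegral_of_continuous' ?_ 0 h
  simp only [Function.uncurry_def]
  fun_prop

theorem differentiableOn_movingAverage {k : ℝ → ℂ} {h : ℝ} {u : ℂ → ℂ} (hk : Continuous k)
    (hu : Continuous u) (hud : DifferentiableOn ℂ u upperHalf) :
    DifferentiableOn ℂ (movingAverage k h u) upperHalf := by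
  intro z hz
  have hz' : 0 < z.im := hz
  set B := closedBall z (z.im / 2)
  have hBU : ∀ w ∈ B, ∀ s : ℝ, w + s ∈ upperHalf := by
    intro w hw s
    have h1 : ‖w - z‖ ≤ z.im / 2 := by simpa [B, dist_eq_norm] using hw
    have h2 := abs_im_le_norm (w - z)
    rw [sub_im] at h2
    have h3 := (abs_le.1 (h2.trans h1)).1
    show 0 < (w + s).im
    simp; linarith
  have hdc : ContinuousOn (deriv u) upperHalf :=
    (hud.analyticOnNhd isOpen_upperHalf).deriv.continuousOn
  have hdc2 : ContinuousOn (fun p : ℂ × ℝ => k p.2 * deriv u (p.1 + p.2)) (B ×ˢ uIcc 0 h) := by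
    refine ContinuousOn.mul (by fun_prop) (hdc.comp (by fun_prop) fun p hp => hBU _ hp.1 _)
  obtain ⟨C, hC⟩ := ((isCompact_closedBall z (z.im / 2)).prod isCompact_uIcc).exists_bound_of_continuousOn
    hdc2
  have hd := intervalIntegral.hasDerivAt_integral_of_dominated_loc_of_deriv_le (μ := volume)
    (F := fun (w : ℂ) (s : ℝ) => k s * u (w + s)) (F' := fun (w : ℂ) (s : ℝ) => k s * deriv u (w + s))
    (x₀ := z) (s := B) (a := 0) (b := h) (bound := fun _ => C)
    (closedBall_mem_nhds z (by positivity)) ?_ ?_ ?_ ?_ ?_ ?_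
  · exact hd.2.differentiableAt.differentiableWithinAt
  · refine Eventually.of_forall fun w => Continuous.aestronglyMeasurable (by fun_prop)
  · exact Continuous.intervalIntegrable (by fun_prop) _ _
  · refine Continuous.aestronglyMeasurable (hk.mul ?_)
    refine hdc.comp_continuous (by fun_prop) fun s => hBU z (mem_closedBall_self (by positivity)) s
  · refine Eventually.of_forall fun s hs w hw => hC (w, s) ⟨hw, uIoc_subset_uIcc hs⟩
  · exact intervalIntegrable_const
  · refine Eventually.of_forall fun s hs w hw => ?_
    have := (hud.differentiableAt (isOpen_upperHalf.mem_nhds (hBU w hw s))).hasDerivAt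
    exact (this.comp_add_const w s).const_mul (k s)

/-- The weight `k` is used with two values only: the constant 1 and an exponential `s ↦ exp(ics)`,
unimodular on the real line. -/
theorem norm_movingAverage_le {k : ℝ → ℂ} {h C : ℝ} {u : ℂ → ℂ} {z : ℂ} (hh : 0 ≤ h)
    (hk : ∀ s, ‖k s‖ ≤ 1) (hC : ∀ s ∈ Icc 0 h, ‖u (z + (s : ℝ))‖ ≤ C) :
    ‖movingAverage k h u z‖ ≤ C * h := by
  have := intervalIntegral.norm_integral_le_of_norm_le_const (a := 0) (b := h)
    (f := fun s : ℝ => k s * u (z + s)) (C := C) (fun s hs => by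
      rw [uIoc_of_le hh] at hs
      rw [norm_mul]
      exact (mul_le_of_le_one_left (norm_nonneg _) (hk s)).trans (hC s ⟨hs.1.le, hs.2⟩))
  rwa [sub_zero, abs_of_nonneg hh] at this

/-- From `|u| ≤ |u|² + 1`: averaging turns square integrable boundary values into bounded ones. -/
theorem norm_movingAverage_ofReal_le {k : ℝ → ℂ} {h : ℝ} {u : ℂ → ℂ} (hh : 0 ≤ h)
    (hk : ∀ s, ‖k s‖ ≤ 1) (hu : Continuous u) (hL : MemLp (fun t : ℝ => u t) 2) (t : ℝ) :
    ‖movingAverage k h u t‖ ≤ (∫ x : ℝ, ‖u x‖ ^ 2) + h := by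
  have hi : Integrable (fun x : ℝ => ‖u x‖ ^ 2) := hL.integrable_norm_pow two_ne_zero
  have hi2 : Integrable (fun s : ℝ => ‖u (t + s)‖ ^ 2) := by
    have := hi.comp_add_left t
    simpa using this
  have h1 := intervalIntegral.norm_integral_le_of_norm_le (a := 0) (b := h) (μ := volume)
    (f := fun s : ℝ => k s * u (t + s)) (g := fun s : ℝ => ‖u (t + s)‖ ^ 2 + 1) hh
    (Eventually.of_forall fun s _ => by
      rw [norm_mul]
      have := mul_le_of_le_one_left (norm_nonneg (u (t + s))) (hk s)
      nlinarith [sq_nonneg (‖u (t + s)‖ - 1)])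
    (Continuous.intervalIntegrable (by fun_prop) _ _)
  refine h1.trans ?_
  rw [intervalIntegral.integral_add (Continuous.intervalIntegrable (by fun_prop) _ _)
    intervalIntegrable_const, intervalIntegral.integral_const, sub_zero, smul_eq_mul, mul_one]
  gcongr
  rw [intervalIntegral.integral_of_le hh]
  refine (setIntegral_le_integral hi2 (Eventually.of_forall fun s => by positivity)).trans_eq ?_
  have := integral_add_left_eq_self (μ := volume) (fun x : ℝ => ‖u x‖ ^ 2) t
  simpa using this

theorem cauchyInt_comp_add (u : ℂ → ℂ) (z : ℂ) (s : ℝ) :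
    ∫ t : ℝ, u (t + s) / ((t : ℂ) - z) = cauchyInt (fun t => u t) (z + s) := by
  have := integral_add_right_eq_self (μ := volume) (fun t : ℝ => u t / ((t : ℂ) - (z + s))) s
  rw [cauchyInt, ← this]
  refine integral_congr_ae (Eventually.of_forall fun t => ?_)
  simp only [ofReal_add]
  congr 1
  ring

/-- Moving averages commute with the Cauchy integral. -/
theorem cauchyInt_movingAverage {u : ℂ → ℂ} {h : ℝ} (hh : 0 ≤ h) (hu : Continuous u)
    (hL : MemLp (fun t : ℝ => u t) 2) {z : ℂ} (hz : z.im ≠ 0) :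
    (Integrable fun t : ℝ => movingAverage 1 h u t / ((t : ℂ) - z)) ∧
      cauchyInt (fun t => movingAverage 1 h u t) z =
        ∫ s in (0 : ℝ)..h, cauchyInt (fun t => u t) (z + s) := by
  have hLs : ∀ s : ℝ, MemLp (fun t : ℝ => u (t + s)) 2 := by
    intro s
    have := hL.comp_measurePreserving (measurePreserving_add_right volume s)
    simpa [Function.comp_def] using this
  have hsq : ∀ s : ℝ, ∫ t : ℝ, ‖u (t + s)‖ ^ 2 = ∫ t : ℝ, ‖u t‖ ^ 2 := by
    intro s
    have := integral_add_right_eq_self (μ := volume) (fun x : ℝ => ‖u x‖ ^ 2) s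
    simpa using this
  have hk2 : Integrable fun t : ℝ => ‖((t : ℂ) - z)⁻¹‖ ^ 2 :=
    (memLp_inv_ofReal_sub hz).integrable_norm_pow two_ne_zero
  -- Fubini applies since `|ab| ≤ |a|² + |b|²` bounds the inner integrals uniformly in the shift
  -- `s`.
  have hint : Integrable (Function.uncurry fun (s t : ℝ) => u (t + s) / ((t : ℂ) - z))
      ((volume.restrict (Ioc 0 h)).prod volume) := by
    have hm : Continuous (Function.uncurry fun (s t : ℝ) => u (t + s) / ((t : ℂ) - z)) := by
      simp only [Function.uncurry_def]
      exact Continuous.div (by fun_prop) (by fun_prop) fun p => ofReal_sub_ne_zero hz p.2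
    rw [MeasureTheory.integrable_prod_iff hm.aestronglyMeasurable]
    refine ⟨Eventually.of_forall fun s => integrable_div_ofReal_sub (hLs s) hz, ?_⟩
    refine Integrable.mono' (g := fun _ => (∫ t : ℝ, ‖u t‖ ^ 2) + ∫ t : ℝ, ‖((t : ℂ) - z)⁻¹‖ ^ 2)
      (integrable_const _) hm.aestronglyMeasurable.norm.integral_prod_right' ?_
    refine Eventually.of_forall fun s => ?_
    rw [Real.norm_of_nonneg (integral_nonneg fun t => norm_nonneg _), ← hsq s,
      ← integral_add ((hLs s).integrable_norm_pow two_ne_zero) hk2]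
    refine integral_mono (integrable_div_ofReal_sub (hLs s) hz).norm
      (((hLs s).integrable_norm_pow two_ne_zero).add hk2) fun t => ?_
    simp only [Function.uncurry_apply_pair]
    rw [div_eq_mul_inv, norm_mul]
    nlinarith [sq_nonneg (‖u (t + s)‖ - ‖((t : ℂ) - z)⁻¹‖), sq_nonneg ‖u (t + s)‖,
      sq_nonneg ‖((t : ℂ) - z)⁻¹‖]
  have hav : ∀ t : ℝ, movingAverage 1 h u t / ((t : ℂ) - z) =
      ∫ s in Ioc 0 h, u (t + s) / ((t : ℂ) - z) := by
    intro t
    rw [movingAverage, intervalIntegral.integral_of_le hh, integral_div]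
    simp
  constructor
  · simp_rw [hav]
    exact hint.integral_prod_right
  · rw [cauchyInt]
    simp_rw [hav]
    rw [← integral_integral_swap hint, intervalIntegral.integral_of_le hh]
    simp_rw [cauchyInt_comp_add]

/-- Both primitives have the same one-sided derivative at 0. This recovers a function from its
averages over short segments. -/
theorem eq_of_forall_integral_eq {φ ψ : ℝ → ℂ} (hφ : Continuous φ) (hψ : Continuous ψ)
    (h : ∀ x ∈ Icc (0 : ℝ) 1, ∫ s in (0 : ℝ)..x, φ s = ∫ s in (0 : ℝ)..x, ψ s) : φ 0 = ψ 0 := by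
  have h1 := (hφ.integral_hasStrictDerivAt 0 0).hasDerivAt.hasDerivWithinAt (s := Icc 0 1)
  have h2 := (hψ.integral_hasStrictDerivAt 0 0).hasDerivAt.hasDerivWithinAt (s := Icc 0 1)
  have h3 := h2.congr (f₁ := fun x => ∫ s in (0 : ℝ)..x, φ s) (fun x hx => h x hx) (h 0 (by simp))
  exact (uniqueDiffOn_Icc one_pos (0 : ℝ) (by simp)).eq_deriv _ h1 h3

/-- Cauchy's formula holds for the bounded averages, and averaging commutes with the Cauchy
integral; differentiating in the length of the segment at 0 gives the formula for `u`. -/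
theorem cauchyInt_eq_of_bounded_movingAverage {u : ℂ → ℂ} (hu : Continuous u)
    (hud : DifferentiableOn ℂ u upperHalf) (hL : MemLp (fun t : ℝ => u t) 2)
    (hb : ∀ h ∈ Icc (0 : ℝ) 1, ∃ M : ℝ, ∀ z : ℂ, 0 ≤ z.im → ‖movingAverage 1 h u z‖ ≤ M) :
    (∀ z : ℂ, 0 < z.im → cauchyInt (fun t => u t) z = 2 * Real.pi * I * u z) ∧
      ∀ z : ℂ, z.im < 0 → cauchyInt (fun t => u t) z = 0 := by
  have hcc : ∀ z : ℂ, z.im ≠ 0 → Continuous fun s : ℝ => cauchyInt (fun t => u t) (z + s) := by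
    intro z hz
    refine continuous_iff_continuousAt.2 fun s => ?_
    have : ContinuousAt (cauchyInt fun t => u t) (z + s) :=
      (differentiableAt_cauchyInt hL (by simpa using hz)).continuousAt
    exact ContinuousAt.comp (f := fun s : ℝ => z + s) this (by fun_prop)
  constructor
  · intro z hz
    have := eq_of_forall_integral_eq (φ := fun s : ℝ => cauchyInt (fun t => u t) (z + s))
      (ψ := fun s : ℝ => 2 * Real.pi * I * u (z + s)) (hcc z hz.ne') (by fun_prop) (by
        intro x hx
        obtain ⟨M, hM⟩ := hb x hx
        obtain ⟨h1, h2⟩ := cauchyInt_movingAverage hx.1 hu hL hz.ne'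
        rw [← h2, cauchyInt_eq_of_bounded (continuous_movingAverage continuous_one hu)
          (differentiableOn_movingAverage continuous_one hu hud) hM hz h1, movingAverage,
          intervalIntegral.integral_const_mul]
        simp)
    simpa using this
  · intro z hz
    have := eq_of_forall_integral_eq (φ := fun s : ℝ => cauchyInt (fun t => u t) (z + s))
      (ψ := fun s : ℝ => 0) (hcc z hz.ne) (by fun_prop) (by
        intro x hx
        obtain ⟨M, hM⟩ := hb x hx
        obtain ⟨h1, h2⟩ := cauchyInt_movingAverage hx.1 hu hL hz.ne
        rw [← h2, cauchyInt_eq_zero_of_bounded (continuous_movingAverage continuous_one hu)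
          (differentiableOn_movingAverage continuous_one hu hud) hM hz h1]
        simp)
    simpa using this

end DeBranges
end

/-! ### Cauchy's formula under a growth condition and nonpositive mean type. -/

noncomputable section
namespace DeBranges
open Complex Metric Set Filter Topology MeasureTheory

theorem norm_movingAverage_le_exp {u : ℂ → ℂ} {A : ℝ} (hu : Continuous u)
    (hud : DifferentiableOn ℂ u upperHalf) (hL : MemLp (fun t : ℝ => u t) 2) (hA : 0 ≤ A)
    (hgr : ∀ z ∈ upperHalf, ‖u z‖ ≤ Real.exp (A * ((1 + ‖z‖ ^ 2) / z.im))) {k : ℝ → ℂ}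
    (hkc : Continuous k) (hk : ∀ s, ‖k s‖ ≤ 1) {h : ℝ} (hh : h ∈ Icc (0 : ℝ) 1) {z : ℂ}
    (hz : 0 ≤ z.im) :
    ‖movingAverage k h u z‖ ≤ ((∫ x : ℝ, ‖u x‖ ^ 2) + 1) * Real.exp (16 * A * z.im) := by
  have hI : 0 ≤ ∫ x : ℝ, ‖u x‖ ^ 2 := integral_nonneg fun x => by positivity
  -- A horizontal shift by `s ∈ [0, 1]` replaces `1 + |w|²` by at most `4(1 + |w|²)`, so averages
  -- satisfy the growth bound with `4A` and have type `16A`.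
  have := norm_le_exp_im_of_growth (A := 4 * A) (continuous_movingAverage (h := h) hkc hu)
    (differentiableOn_movingAverage hkc hu hud) (by positivity)
    (M := (∫ x : ℝ, ‖u x‖ ^ 2) + 1) (by linarith)
    (fun t => (norm_movingAverage_ofReal_le hh.1 hk hu hL t).trans (by linarith [hh.2])) ?_ hz
  · rwa [show 4 * (4 * A) = 16 * A by ring] at this
  · intro w hw
    have hw' : 0 < w.im := hw
    have h1 := norm_movingAverage_le (k := k) (u := u) (z := w) hh.1 hk
      (C := Real.exp (4 * A * ((1 + ‖w‖ ^ 2) / w.im))) (by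
        intro s hs
        have him : (w + s).im = w.im := by simp
        have hs1 : ‖(s : ℂ)‖ ≤ 1 := by
          rw [norm_real, Real.norm_of_nonneg hs.1]; exact hs.2.trans hh.2
        have hn := norm_add_le w (s : ℂ)
        have hn2 : 1 + ‖w + s‖ ^ 2 ≤ 4 * (1 + ‖w‖ ^ 2) := by
          nlinarith [norm_nonneg w, norm_nonneg (w + s), sq_nonneg (‖w‖ - 1)]
        refine (hgr (w + s) (by show 0 < (w + s).im; rwa [him])).trans (Real.exp_le_exp.2 ?_)
        rw [him]
        calc A * ((1 + ‖w + s‖ ^ 2) / w.im) ≤ A * (4 * (1 + ‖w‖ ^ 2) / w.im) := by gcongr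
          _ = _ := by ring)
    refine h1.trans (mul_le_of_le_one_right (Real.exp_pos _).le hh.2)

theorem norm_exp_mul_I_mul (c : ℝ) (z : ℂ) : ‖exp (c * I * z)‖ = Real.exp (-(c * z.im)) := by
  rw [norm_exp]
  simp

theorem norm_cauchyInt_le {φ : ℝ → ℂ} (hφ : MemLp φ 2) {z : ℂ} (hz : 0 < z.im) :
    ‖cauchyInt φ z‖ ≤ (∫ t : ℝ, ‖φ t‖ ^ 2) + Real.pi / z.im := by
  have h1 : Integrable fun t : ℝ => ‖φ t‖ ^ 2 := hφ.integrable_norm_pow two_ne_zero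
  have h2 := integrable_inv_normSq hz.ne'
  rw [← integral_inv_normSq hz, ← integral_add h1 h2]
  refine norm_integral_le_of_norm_le (h1.add h2) (Eventually.of_forall fun t => ?_)
  rw [div_eq_mul_inv, norm_mul, normSq_eq_norm_sq, ← inv_pow, ← norm_inv]
  nlinarith [sq_nonneg (‖φ t‖ - ‖((t : ℂ) - z)⁻¹‖), sq_nonneg ‖φ t‖, sq_nonneg ‖((t : ℂ) - z)⁻¹‖]

/-- A function of exponential type in `Im z ≥ 1`, bounded on the line `Im z = 1` and of
nonpositive type along the imaginary axis, is bounded. -/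
theorem norm_le_of_exponential_type {u : ℂ → ℂ} {K c : ℝ} (hc : 0 ≤ c)
    (hud : DifferentiableOn ℂ u upperHalf)
    (hb : ∀ z : ℂ, 1 ≤ z.im → ‖u z‖ ≤ K * Real.exp (c * z.im))
    (hax : ∀ ε > 0, ∀ᶠ y : ℝ in atTop, ‖u (I * y)‖ ≤ Real.exp (ε * y)) {z : ℂ} (hz : 1 ≤ z.im) :
    ‖u z‖ ≤ K * Real.exp c := by
  have hK : 0 ≤ K := by
    have h1 := (norm_nonneg _).trans (hb z hz)
    exact nonneg_of_mul_nonneg_left h1 (Real.exp_pos _)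
  -- This carries `Im z ≥ 1` to `Re ζ ≥ 0`. The damping `exp(-εζ)` makes `u` bounded on the positive
  -- axis, and `ε → 0` at the end.
  set ζ : ℂ := -I * z - 1 with hζ
  have hζre : ζ.re = z.im - 1 := by simp [hζ]
  have hζz : I + I * ζ = z := by
    rw [hζ]
    linear_combination (-z) * I_sq
  have key : ∀ ε : ℝ, 0 < ε → ‖u z * exp (-ε * ζ)‖ ≤ K * Real.exp c := by
    intro ε hε
    have him : ∀ w : ℂ, (I + I * w).im = 1 + w.re := fun w => by simp
    have hno : ∀ w : ℂ, 0 ≤ w.re →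
        ‖u (I + I * w) * exp (-ε * w)‖ ≤ K * Real.exp c * Real.exp (c * w.re) := by
      intro w hw
      have h1 := hb (I + I * w) (by rw [him]; linarith)
      rw [him] at h1
      have h2 : ‖exp (-ε * w)‖ ≤ 1 := by
        rw [norm_exp, Real.exp_le_one_iff]
        simp
        positivity
      rw [norm_mul]
      refine (mul_le_of_le_one_right (norm_nonneg _) h2).trans (h1.trans_eq ?_)
      rw [mul_assoc, ← Real.exp_add]
      ring_nf
    have := PhragmenLindelof.right_half_plane_of_bounded_on_real
      (f := fun w => u (I + I * w) * exp (-ε * w)) (C := K * Real.exp c) (z := ζ) ?_ ?_ ?_ ?_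
      (by rw [hζre]; linarith)
    · simpa only [hζz] using this
    · refine DifferentiableOn.diffContOnCl fun w hw => ?_
      have hw0 : 0 ≤ w.re :=
        closure_minimal (t := {w : ℂ | 0 ≤ w.re}) (fun x (hx : 0 < x.re) => hx.le)
          (isClosed_le continuous_const continuous_re) hw
      have h1 : DifferentiableAt ℂ u (I + I * w) := hud.differentiableAt
        (isOpen_upperHalf.mem_nhds (by show 0 < (I + I * w).im; rw [him]; linarith))
      have h2 : DifferentiableAt ℂ (fun w => u (I + I * w)) w :=
        DifferentiableAt.comp (f := fun w => I + I * w) w h1 (by fun_prop)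
      exact (h2.mul (by fun_prop)).differentiableWithinAt
    · refine ⟨1, one_lt_two, c, Asymptotics.IsBigO.of_bound (K * Real.exp c) ?_⟩
      refine (eventually_principal.2 fun w hw => ?_).filter_mono inf_le_right
      have hw0 : 0 < w.re := hw
      refine (hno w hw0.le).trans ?_
      rw [Real.rpow_one, Real.norm_of_nonneg (Real.exp_pos _).le]
      gcongr
      exact re_le_norm w
    · refine ⟨Real.exp ε, eventually_map.2 ?_⟩
      have h1 := (tendsto_atTop_add_const_left atTop (1 : ℝ) tendsto_id).eventually (hax ε hε)
      filter_upwards [h1] with x hx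
      have hx' : I + I * (x : ℂ) = I * ((1 + id x : ℝ) : ℂ) := by push_cast; simp only [id]; ring
      rw [norm_mul, norm_exp, hx']
      have : (-ε * (x : ℂ)).re = -(ε * x) := by simp
      rw [this]
      refine (mul_le_mul_of_nonneg_right hx (Real.exp_pos _).le).trans_eq ?_
      rw [← Real.exp_add]
      simp only [id]
      ring_nf
    · intro x
      simpa using hno (x * I) (by simp)
  have hlim : Tendsto (fun ε : ℝ => ‖u z * exp (-ε * ζ)‖) (𝓝[>] 0) (𝓝 ‖u z‖) := by
    have : Continuous (fun ε : ℝ => ‖u z * exp (-ε * ζ)‖) := by fun_prop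
    have h := (this.tendsto 0).mono_left (nhdsWithin_le_nhds (s := Ioi 0))
    simpa using h
  refine le_of_tendsto hlim ?_
  filter_upwards [self_mem_nhdsWithin] with ε hε using key ε hε

/-- Cauchy's formula for functions with square integrable boundary values whose logarithm is at
most `A (1 + |z|²) / Im z` and which have nonpositive mean type. -/
theorem cauchyInt_eq_of_growth {u : ℂ → ℂ} {A : ℝ} (hu : Continuous u)
    (hud : DifferentiableOn ℂ u upperHalf) (hL : MemLp (fun t : ℝ => u t) 2) (hA : 0 ≤ A)
    (hgr : ∀ z ∈ upperHalf, ‖u z‖ ≤ Real.exp (A * ((1 + ‖z‖ ^ 2) / z.im)))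
    (hax : ∀ ε > 0, ∀ᶠ y : ℝ in atTop, ‖u (I * y)‖ ≤ Real.exp (ε * y)) :
    (∀ z : ℂ, 0 < z.im → cauchyInt (fun t => u t) z = 2 * Real.pi * I * u z) ∧
      ∀ z : ℂ, z.im < 0 → cauchyInt (fun t => u t) z = 0 := by
  set c := 16 * A
  set B := ∫ x : ℝ, ‖u x‖ ^ 2
  have hB : 0 ≤ B := integral_nonneg fun x => by positivity
  -- The factor `exp(icz)` compensates the type `c` of the averages: an average of `g` is `exp(icz)`
  -- times an average of `u` with weight `exp(ics)`, hence bounded, and Cauchy's formula holds for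
  -- `g`.
  set g : ℂ → ℂ := fun z => exp (c * I * z) * u z with hg
  have hgreal : ∀ t : ℝ, ‖g t‖ = ‖u t‖ := fun t => by
    rw [hg]; simp only; rw [norm_mul, norm_exp_mul_I_mul]; simp
  have hgc : Continuous g := by fun_prop
  have hgL : MemLp (fun t : ℝ => g t) 2 :=
    hL.of_le (Continuous.aestronglyMeasurable (by fun_prop))
      (Eventually.of_forall fun t => (hgreal t).le)
  have hgd : DifferentiableOn ℂ g upperHalf := DifferentiableOn.mul (by fun_prop) hud
  have hgC := (cauchyInt_eq_of_bounded_movingAverage hgc hgd hgL fun h hh => by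
    refine ⟨B + 1, fun z hz => ?_⟩
    have h1 : movingAverage 1 h g z =
        exp (c * I * z) * movingAverage (fun s => exp (c * I * s)) h u z := by
      rw [movingAverage, movingAverage, ← intervalIntegral.integral_const_mul]
      refine intervalIntegral.integral_congr fun s _ => ?_
      simp only [hg, Pi.one_apply, one_mul, mul_add, exp_add]
      ring
    have h2 := norm_movingAverage_le_exp hu hud hL hA hgr
      (k := fun s => exp (c * I * s)) (by fun_prop)
      (fun s => by rw [norm_exp_mul_I_mul]; simp) hh hz
    rw [h1, norm_mul, norm_exp_mul_I_mul]
    refine (mul_le_mul_of_nonneg_left h2 (Real.exp_pos _).le).trans_eq ?_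
    rw [mul_left_comm, ← Real.exp_add, neg_add_cancel, Real.exp_zero, mul_one]).1
  -- The formula for `g` passes from averages to a pointwise bound: `u` itself has exponential type
  -- in `Im z ≥ 1`. The mean type condition then makes it bounded there.
  have hexp : ∀ z : ℂ, 1 ≤ z.im → ‖u z‖ ≤ (B + Real.pi) * Real.exp (c * z.im) := by
    intro z hz
    have hz0 : 0 < z.im := by linarith
    have h1 := norm_cauchyInt_le hgL hz0
    rw [hgC z hz0] at h1
    simp_rw [hgreal] at h1
    have h2 : ‖g z‖ ≤ ‖2 * Real.pi * I * g z‖ := by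
      have : ‖(2 * Real.pi * I : ℂ)‖ = 2 * Real.pi := by simp [abs_of_pos Real.pi_pos]
      rw [norm_mul _ (g z), this]
      nlinarith [Real.pi_gt_three, norm_nonneg (g z)]
    have h3 : Real.pi / z.im ≤ Real.pi := div_le_self Real.pi_pos.le hz
    have h4 : ‖g z‖ = ‖u z‖ * Real.exp (-(c * z.im)) := by
      rw [hg]; simp only; rw [norm_mul, norm_exp_mul_I_mul, mul_comm]
    have h5 : ‖u z‖ * Real.exp (-(c * z.im)) ≤ B + Real.pi := by linarith
    rwa [Real.exp_neg, ← div_eq_mul_inv, div_le_iff₀ (Real.exp_pos _)] at h5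
  have hbd := fun (z : ℂ) (hz : 1 ≤ z.im) =>
    norm_le_of_exponential_type (by positivity) hud hexp hax hz
  -- Averages of `u` are bounded: in the strip `0 ≤ Im z ≤ 1` by their exponential bound, above it
  -- by the bound on `u`.
  refine cauchyInt_eq_of_bounded_movingAverage hu hud hL fun h hh =>
    ⟨max ((B + 1) * Real.exp (16 * A)) ((B + Real.pi) * Real.exp c), fun z hz => ?_⟩
  rcases le_total z.im 1 with h1 | h1
  · refine le_max_of_le_left ((norm_movingAverage_le_exp hu hud hL hA hgr continuous_one
      (fun s => by simp) hh hz).trans ?_)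
    have : 16 * A * z.im ≤ 16 * A := mul_le_of_le_one_right (by positivity) h1
    gcongr
  · refine le_max_of_le_right ((norm_movingAverage_le (u := u) hh.1 (fun s => by simp)
      (fun s hs => hbd _ (by simpa using h1))).trans ?_)
    exact mul_le_of_le_one_right (by positivity) hh.2

end DeBranges
end

/-! ### Algebra of bounded type functions, de Branges spaces and Hermite–Biehler functions. -/

noncomputable section
namespace DeBranges
open Complex Metric Set Filter Topology MeasureTheory

theorem meanType_nonpos_iff {f : ℂ → ℂ} :
    meanType f ≤ 0 ↔ ∀ ε > 0, ∀ᶠ y : ℝ in atTop, ‖f (I * y)‖ ≤ Real.exp (ε * y) := by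
  have key : ∀ (ε y : ℝ), 0 < y → (ENNReal.log ‖f (I * y)‖ₑ / (y : EReal) ≤ (ε : EReal) ↔
      ‖f (I * y)‖ ≤ Real.exp (ε * y)) := by
    intro ε y hy
    have hy' : (0 : EReal) < (y : EReal) := by exact_mod_cast hy
    rw [EReal.div_le_iff_le_mul hy' (EReal.coe_ne_top y), ← EReal.coe_mul,
      ← Real.log_exp (y * ε), ← ENNReal.log_ofReal_of_pos (Real.exp_pos _),
      ENNReal.log_le_log_iff, ← ofReal_norm,
      ENNReal.ofReal_le_ofReal_iff (Real.exp_pos _).le, mul_comm y ε]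
  constructor
  · intro h ε hε
    have h1 : meanType f < (ε : EReal) := lt_of_le_of_lt h (by exact_mod_cast hε)
    filter_upwards [eventually_lt_of_limsup_lt h1, eventually_gt_atTop 0] with y hy hy0
    exact (key ε y hy0).1 hy.le
  · intro h
    by_contra! hlt
    obtain ⟨ε, hε0, hε⟩ := EReal.lt_iff_exists_real_btwn.1 hlt
    have hε0' : 0 < ε := by exact_mod_cast hε0
    have : meanType f ≤ (ε : EReal) := by
      refine limsup_le_of_le (h := ?_)
      filter_upwards [h ε hε0', eventually_gt_atTop 0] with y hy hy0
      exact (key ε y hy0).2 hy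
    exact absurd hε (not_lt.2 this)

/-- Functions of bounded type and nonpositive mean type in the upper half-plane. -/
def IsSmirnov (f : ℂ → ℂ) : Prop := IsBoundedType f ∧ meanType f ≤ 0

theorem mem_space_iff {E f : ℂ → ℂ} : f ∈ space E ↔ Differentiable ℂ f ∧
    MemLp (fun t : ℝ => f (t : ℂ) / E (t : ℂ)) 2 ∧
    IsSmirnov (fun z => f z / E z) ∧ IsSmirnov (fun z => starFn f z / E z) :=
  ⟨fun ⟨a, b, c, d, e, g⟩ => ⟨a, b, ⟨c, d⟩, ⟨e, g⟩⟩, fun ⟨a, b, ⟨c, d⟩, ⟨e, g⟩⟩ => ⟨a, b, c, d, e, g⟩⟩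

theorem I_mul_mem_upperHalf {y : ℝ} (hy : 0 < y) : I * (y : ℂ) ∈ upperHalf := by
  show 0 < (I * (y : ℂ)).im
  simpa using hy

theorem IsSmirnov.congr {f g : ℂ → ℂ} (hf : IsSmirnov f) (h : EqOn f g upperHalf) :
    IsSmirnov g := by
  obtain ⟨⟨hd, P, Q, hP, hQ, hPb, hQb, hQ0, hPQ⟩, hm⟩ := hf
  refine ⟨⟨hd.congr fun z hz => (h hz).symm, P, Q, hP, hQ, hPb, hQb, hQ0,
    fun z hz => h hz ▸ hPQ z hz⟩, ?_⟩
  rw [meanType_nonpos_iff] at hm ⊢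
  intro ε hε
  filter_upwards [hm ε hε, eventually_gt_atTop 0] with y hy hy0
  rwa [← h (I_mul_mem_upperHalf hy0)]

/-- Analytic functions on a connected set have no zero divisors; needed for the common denominator
of a sum. -/
theorem exists_ne_zero_mul {Q₁ Q₂ : ℂ → ℂ} (h₁ : DifferentiableOn ℂ Q₁ upperHalf)
    (h₂ : DifferentiableOn ℂ Q₂ upperHalf) (hQ₁ : ∃ z ∈ upperHalf, Q₁ z ≠ 0)
    (hQ₂ : ∃ z ∈ upperHalf, Q₂ z ≠ 0) : ∃ z ∈ upperHalf, Q₁ z * Q₂ z ≠ 0 := by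
  by_contra! h
  have ha₁ := h₁.analyticOnNhd isOpen_upperHalf
  have ha₂ := h₂.analyticOnNhd isOpen_upperHalf
  rcases ha₁.eq_zero_or_eq_zero_of_mul_eq_zero ha₂ (fun z hz => h z hz)
    convex_upperHalf.isPreconnected with h0 | h0
  · obtain ⟨z, hz, hne⟩ := hQ₁; exact hne (h0 z hz)
  · obtain ⟨z, hz, hne⟩ := hQ₂; exact hne (h0 z hz)

theorem IsSmirnov.add {f g : ℂ → ℂ} (hf : IsSmirnov f) (hg : IsSmirnov g) :
    IsSmirnov fun z => f z + g z := by
  obtain ⟨⟨hd₁, P₁, Q₁, hP₁, hQ₁, ⟨C₁, hC₁⟩, ⟨D₁, hD₁⟩, h0₁, hPQ₁⟩, hm₁⟩ := hf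
  obtain ⟨⟨hd₂, P₂, Q₂, hP₂, hQ₂, ⟨C₂, hC₂⟩, ⟨D₂, hD₂⟩, h0₂, hPQ₂⟩, hm₂⟩ := hg
  refine ⟨⟨hd₁.add hd₂, fun z => P₁ z * Q₂ z + P₂ z * Q₁ z, fun z => Q₁ z * Q₂ z,
    (hP₁.mul hQ₂).add (hP₂.mul hQ₁), hQ₁.mul hQ₂, ⟨C₁ * D₂ + C₂ * D₁, fun z hz => ?_⟩,
    ⟨D₁ * D₂, fun z hz => ?_⟩, exists_ne_zero_mul hQ₁ hQ₂ h0₁ h0₂, fun z hz => ?_⟩, ?_⟩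
  · have c₁ := (norm_nonneg _).trans (hC₁ z hz)
    have c₂ := (norm_nonneg _).trans (hC₂ z hz)
    refine (norm_add_le _ _).trans ?_
    rw [norm_mul, norm_mul]
    gcongr
    exacts [hC₁ z hz, hD₂ z hz, hC₂ z hz, hD₁ z hz]
  · have c₁ := (norm_nonneg _).trans (hD₁ z hz)
    rw [norm_mul]
    gcongr
    exacts [hD₁ z hz, hD₂ z hz]
  · simp only [← hPQ₁ z hz, ← hPQ₂ z hz]; ring
  · rw [meanType_nonpos_iff] at hm₁ hm₂ ⊢
    intro ε hε
    have hlarge : ∀ᶠ y : ℝ in atTop, 2 ≤ Real.exp (ε / 2 * y) :=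
      (Real.tendsto_exp_atTop.comp (tendsto_id.const_mul_atTop (half_pos hε))).eventually_ge_atTop 2
    filter_upwards [hm₁ _ (half_pos hε), hm₂ _ (half_pos hε), hlarge] with y h1 h2 h3
    calc _ ≤ _ := norm_add_le _ _
      _ ≤ 2 * Real.exp (ε / 2 * y) := by linarith
      _ ≤ Real.exp (ε / 2 * y) * Real.exp (ε / 2 * y) := by gcongr
      _ = Real.exp (ε * y) := by rw [← Real.exp_add]; ring_nf

/-- Bounded analytic functions act on the functions of bounded type and nonpositive mean type. -/
theorem IsSmirnov.mul_bounded {f θ : ℂ → ℂ} {C : ℝ} (hf : IsSmirnov f)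
    (hθ : DifferentiableOn ℂ θ upperHalf) (hC : ∀ z ∈ upperHalf, ‖θ z‖ ≤ C) :
    IsSmirnov fun z => f z * θ z := by
  obtain ⟨⟨hd, P, Q, hP, hQ, ⟨C₁, hC₁⟩, hQb, h0, hPQ⟩, hm⟩ := hf
  refine ⟨⟨hd.mul hθ, fun z => P z * θ z, Q, hP.mul hθ, hQ, ⟨C₁ * C, fun z hz => ?_⟩, hQb, h0,
    fun z hz => ?_⟩, ?_⟩
  · have c₁ := (norm_nonneg _).trans (hC₁ z hz)
    rw [norm_mul]
    gcongr
    exacts [hC₁ z hz, hC z hz]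
  · simp only [← hPQ z hz]; ring
  · rw [meanType_nonpos_iff] at hm ⊢
    intro ε hε
    have hlarge : ∀ᶠ y : ℝ in atTop, C ≤ Real.exp (ε / 2 * y) :=
      (Real.tendsto_exp_atTop.comp (tendsto_id.const_mul_atTop (half_pos hε))).eventually_ge_atTop C
    filter_upwards [hm _ (half_pos hε), hlarge, eventually_gt_atTop 0] with y h1 h2 h3
    rw [norm_mul]
    calc _ ≤ Real.exp (ε / 2 * y) * Real.exp (ε / 2 * y) := by
          gcongr
          exact (hC _ (I_mul_mem_upperHalf h3)).trans h2
      _ = Real.exp (ε * y) := by rw [← Real.exp_add]; ring_nf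

theorem IsSmirnov.const_mul {f : ℂ → ℂ} (hf : IsSmirnov f) (c : ℂ) :
    IsSmirnov fun z => c * f z := by
  simpa [mul_comm] using hf.mul_bounded (θ := fun _ => c) (differentiableOn_const c)
    (fun _ _ => le_rfl)

theorem isSmirnov_zero : IsSmirnov fun _ => 0 := by
  refine ⟨⟨differentiableOn_const 0, fun _ => 0, fun _ => 1, differentiableOn_const 0,
    differentiableOn_const 1, ⟨0, by simp⟩, ⟨1, by simp⟩, ⟨I, ?_, one_ne_zero⟩, by simp⟩, ?_⟩
  · show 0 < I.im
    simp
  · rw [meanType_nonpos_iff]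
    intro ε hε
    exact Eventually.of_forall fun y => by simpa using (Real.exp_pos _).le

theorem starFn_starFn (f : ℂ → ℂ) : starFn (starFn f) = f := by
  ext z; simp [starFn]

theorem starFn_ofReal (f : ℂ → ℂ) (t : ℝ) : starFn f t = conj (f t) := by
  simp [starFn]

theorem differentiable_starFn {f : ℂ → ℂ} (hf : Differentiable ℂ f) :
    Differentiable ℂ (starFn f) := by
  intro z
  have h : DifferentiableAt ℂ f (conj z) := hf _
  simpa [starFn, Function.comp_def] using! h.conj_conj

theorem starFn_mem_space {E f : ℂ → ℂ} (hE : Differentiable ℂ E) (hf : f ∈ space E) :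
    starFn f ∈ space E := by
  rw [mem_space_iff] at hf ⊢
  refine ⟨differentiable_starFn hf.1, ?_, hf.2.2.2, by rw [starFn_starFn]; exact hf.2.2.1⟩
  have h1 := (differentiable_starFn hf.1).continuous
  have h2 := hE.continuous
  refine hf.2.1.of_le ?_ (Eventually.of_forall fun t => ?_)
  · exact ((h1.comp continuous_ofReal).measurable.div
      (h2.comp continuous_ofReal).measurable).aestronglyMeasurable
  · rw [starFn_ofReal, norm_div, norm_div, RCLike.norm_conj]

theorem add_mem_space {E f g : ℂ → ℂ} (hf : f ∈ space E) (hg : g ∈ space E) :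
    f + g ∈ space E := by
  rw [mem_space_iff] at hf hg ⊢
  refine ⟨hf.1.add hg.1, (hf.2.1.add hg.2.1).congr_norm ?_ (Eventually.of_forall fun t => ?_),
    (hf.2.2.1.add hg.2.2.1).congr fun z _ => ?_, (hf.2.2.2.add hg.2.2.2).congr fun z _ => ?_⟩
  · simpa [add_div] using! (hf.2.1.1.add hg.2.1.1)
  · simp [add_div]
  · simp [add_div]
  · simp [add_div, starFn]

theorem const_mul_mem_space {E f : ℂ → ℂ} (c : ℂ) (hf : f ∈ space E) :
    (fun z => c * f z) ∈ space E := by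
  rw [mem_space_iff] at hf ⊢
  refine ⟨hf.1.const_mul c, ?_, (hf.2.2.1.const_mul c).congr fun z _ => ?_,
    (hf.2.2.2.const_mul (conj c)).congr fun z _ => ?_⟩
  · simpa [mul_div_assoc] using hf.2.1.const_mul c
  · simp [mul_div_assoc]
  · simp [mul_div_assoc, starFn]

theorem zero_mem_space (E : ℂ → ℂ) : (0 : ℂ → ℂ) ∈ space E := by
  rw [mem_space_iff]
  refine ⟨differentiable_const 0, by simp, ?_, ?_⟩
  · simpa using isSmirnov_zero
  · simpa [starFn] using isSmirnov_zero

theorem IsHermiteBiehler.ne_zero {E : ℂ → ℂ} (hE : IsHermiteBiehler E) {z : ℂ}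
    (hz : 0 < z.im) : E z ≠ 0 :=
  norm_pos_iff.1 ((norm_nonneg _).trans_lt (hE.2 z hz))

theorem IsHermiteBiehler.mul {E F : ℂ → ℂ} (hE : IsHermiteBiehler E) (hF : IsHermiteBiehler F) :
    IsHermiteBiehler (E * F) := by
  refine ⟨hE.1.mul hF.1, fun z hz => ?_⟩
  simp only [Pi.mul_apply, norm_mul]
  exact mul_lt_mul'' (hE.2 z hz) (hF.2 z hz) (norm_nonneg _) (norm_nonneg _)

theorem IsHermiteBiehler.norm_starFn_div_le {E : ℂ → ℂ} (hE : IsHermiteBiehler E) {z : ℂ}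
    (hz : z ∈ upperHalf) : ‖starFn E z / E z‖ ≤ 1 := by
  rw [norm_div, starFn, RCLike.norm_conj]
  exact div_le_one_of_le₀ (hE.2 z hz).le (norm_nonneg _)

theorem IsHermiteBiehler.differentiableOn_div {E f : ℂ → ℂ} (hE : IsHermiteBiehler E)
    (hf : Differentiable ℂ f) : DifferentiableOn ℂ (fun z => f z / E z) upperHalf :=
  hf.differentiableOn.div hE.1.differentiableOn fun _ hz => hE.ne_zero hz

/-- `E` may have real zeros, but as `E(i) ≠ 0` they are isolated; division by `E` on the line is
legitimate almost everywhere. -/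
theorem IsHermiteBiehler.ae_ne_zero {E : ℂ → ℂ} (hE : IsHermiteBiehler E) :
    ∀ᵐ t : ℝ, E (t : ℂ) ≠ 0 := by
  have ha : AnalyticOnNhd ℂ E univ := fun z _ => hE.1.analyticAt z
  have hI : E I ≠ 0 := hE.ne_zero (by simp)
  have hr : AnalyticOnNhd ℝ (fun t : ℝ => E (t : ℂ)) univ := fun t _ =>
    (ha t (mem_univ _)).restrictScalars.comp (ofRealCLM.analyticAt t)
  have hcod : ∀ᶠ t : ℝ in codiscreteWithin univ, E (t : ℂ) ≠ 0 := by
    refine (hr.eqOn_zero_or_eventually_ne_zero_of_preconnected isPreconnected_univ).resolve_left ?_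
    intro h0
    have hfr : ∃ᶠ z in 𝓝[≠] (0 : ℂ), E z = 0 := by
      have ht : Tendsto (fun t : ℝ => (t : ℂ)) (𝓝[≠] 0) (𝓝[≠] 0) := by
        refine tendsto_nhdsWithin_iff.2 ⟨?_, ?_⟩
        · exact (continuous_ofReal.tendsto' 0 0 (by simp)).mono_left nhdsWithin_le_nhds
        · filter_upwards [self_mem_nhdsWithin] with t ht
          simpa using ht
      exact ht.frequently (Eventually.of_forall fun t => h0 (mem_univ t)).frequently
    exact hI (ha.eqOn_zero_of_preconnected_of_frequently_eq_zero isPreconnected_univ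
      (mem_univ 0) hfr (mem_univ I))
  have := ae_restrict_le_codiscreteWithin (μ := (volume : Measure ℝ)) MeasurableSet.univ hcod
  rwa [Measure.restrict_univ] at this

end DeBranges
end

/-! ### The quotients `f / E` as Cauchy integrals, and the converse. -/

noncomputable section
namespace DeBranges
open Complex Metric Set Filter Topology MeasureTheory

/-- A meromorphic function that is square integrable on the real line has no real pole. -/
theorem meromorphicOrderAt_nonneg_of_memLp {q : ℂ → ℂ} {x : ℝ} (hq : MeromorphicAt q x)
    (hL : MemLp (fun t : ℝ => q t) 2) : 0 ≤ meromorphicOrderAt q x := by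
  by_contra! hneg
  obtain ⟨n, hn⟩ := WithTop.ne_top_iff_exists.1 hneg.ne_top
  rw [← hn] at hneg
  have hn0 : n < 0 := by exact_mod_cast hneg
  obtain ⟨g, hg, hgx, hqg⟩ := (meromorphicOrderAt_eq_int_iff hq).1 hn.symm
  have ht : Tendsto (fun t : ℝ => (t : ℂ)) (𝓝[≠] x) (𝓝[≠] (x : ℂ)) := by
    refine tendsto_nhdsWithin_iff.2 ⟨?_, ?_⟩
    · exact continuous_ofReal.continuousAt.mono_left nhdsWithin_le_nhds
    · filter_upwards [self_mem_nhdsWithin] with t ht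
      simpa using ht
  -- Near `x`, `q = (z - x)ⁿ g` with `n ≤ -1`; this bounded multiplier turns `q` into `1/(z - x)`.
  -- Hence `1/(t - x) = O(q)`, which is impossible because `q` is locally integrable on the line.
  have hcont : ContinuousAt (fun z : ℂ => (z - x) ^ (-n - 1).toNat / g z) x :=
    ContinuousAt.div (by fun_prop) hg.continuousAt hgx
  have hbd : (fun z : ℂ => (z - x) ^ (-n - 1).toNat / g z) =O[𝓝[≠] (x : ℂ)] fun _ => (1 : ℂ) :=
    (hcont.tendsto.isBigO_one ℂ).mono nhdsWithin_le_nhds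
  have hO : (fun z : ℂ => (z - x)⁻¹) =O[𝓝[≠] (x : ℂ)] q := by
    have h1 := hbd.mul (Asymptotics.isBigO_refl q (𝓝[≠] (x : ℂ)))
    have h2 := h1.trans (Asymptotics.isBigO_of_le (g := q) _ fun z => by simp)
    refine h2.congr' ?_ EventuallyEq.rfl
    filter_upwards [hqg, self_mem_nhdsWithin,
      nhdsWithin_le_nhds (hg.continuousAt.eventually_ne hgx)] with z hz hzx hgz
    have hzx' : z - x ≠ 0 := sub_ne_zero.2 hzx
    rw [hz, smul_eq_mul, ← zpow_natCast, Int.toNat_of_nonneg (by lia)]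
    field_simp
    rw [← zpow_one_add₀ hzx', ← zpow_add₀ hzx']
    simp
  have hO2 : (fun t : ℝ => (t - x)⁻¹) =O[𝓝[≠] x] fun t : ℝ => q t := by
    refine (Asymptotics.IsBigO.congr_left (hO.comp_tendsto ht).norm_left fun t => ?_).of_norm_left
    show ‖((t : ℂ) - x)⁻¹‖ = ‖(t - x)⁻¹‖
    rw [← ofReal_sub, norm_inv, norm_inv, norm_real]
  refine not_intervalIntegrable_of_sub_inv_isBigO_punctured hO2 (a := x - 1) (b := x + 1)
    (by linarith) (by rw [uIcc_of_le (by linarith)]; constructor <;> linarith) ?_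
  rw [intervalIntegrable_iff_integrableOn_Ioc_of_le (by linarith)]
  exact (hL.restrict _).integrable (by norm_num)

/-- If `f / E` is square integrable on the real line, it extends continuously to the closed upper
half-plane. -/
theorem IsHermiteBiehler.exists_continuous_quotient {E f : ℂ → ℂ} (hE : IsHermiteBiehler E)
    (hf : Differentiable ℂ f) (hL : MemLp (fun t : ℝ => f t / E t) 2) :
    ∃ u : ℂ → ℂ, Continuous u ∧ EqOn u (fun z => f z / E z) upperHalf ∧
      (fun t : ℝ => u t) =ᵐ[volume] (fun t : ℝ => f t / E t) ∧ ∀ t : ℝ, f t = u t * E t := by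
  set q : ℂ → ℂ := fun z => f z / E z
  have hqm : MeromorphicOn q univ := fun z _ =>
    (hf.analyticAt z).meromorphicAt.div (hE.1.analyticAt z).meromorphicAt
  set v := toMeromorphicNFOn q univ
  have hvq : ∀ z, E z ≠ 0 → v z = q z := by
    intro z hz
    have ha : AnalyticAt ℂ q z := (hf.analyticAt z).div (hE.1.analyticAt z) hz
    simp only [v]
    rw [toMeromorphicNFOn_eq_toMeromorphicNFAt hqm (mem_univ z),
      toMeromorphicNFAt_eq_self.2 ha.meromorphicNFAt]
  have hvc : ContinuousOn v {z | 0 ≤ z.im} := by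
    intro z hz
    have hord : 0 ≤ meromorphicOrderAt v z := by
      simp only [v]
      rw [meromorphicOrderAt_toMeromorphicNFOn hqm (mem_univ z)]
      rcases (show 0 ≤ z.im from hz).eq_or_lt with h0 | hpos
      · have hzr : z = (z.re : ℂ) := Complex.ext rfl (by simpa using h0.symm)
        rw [hzr]
        exact meromorphicOrderAt_nonneg_of_memLp (hqm _ (mem_univ _)) hL
      · exact ((hf.analyticAt z).div (hE.1.analyticAt z)
          (hE.ne_zero hpos)).meromorphicOrderAt_nonneg
    exact ((meromorphicNFOn_toMeromorphicNFOn q univ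
      (mem_univ z)).meromorphicOrderAt_nonneg_iff_analyticAt.1
        hord).continuousAt.continuousWithinAt
  -- Extending the boundary values constantly downwards gives global continuity whatever poles `f /
  -- E` has in the lower half-plane.
  set u : ℂ → ℂ := fun z => v (z.re + (max z.im 0 : ℝ) * I)
  have huv : ∀ z : ℂ, 0 ≤ z.im → u z = v z := by
    intro z hz
    simp only [u]
    rw [max_eq_left hz, re_add_im]
  have huc : Continuous u := by
    refine hvc.comp_continuous ?_ fun z => ?_
    · fun_prop
    · simp
  have hae : (fun t : ℝ => u t) =ᵐ[volume] (fun t : ℝ => q t) := by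
    filter_upwards [hE.ae_ne_zero] with t ht
    rw [huv t (by simp), hvq t ht]
  refine ⟨u, huc, fun z hz => ?_, hae, ?_⟩
  · rw [huv z (le_of_lt hz), hvq z (hE.ne_zero hz)]
  -- Continuity turns almost everywhere equality into equality at every real point, so `f` vanishes
  -- at each real zero of `E`.
  · have h1 : (fun t : ℝ => f t) =ᵐ[volume] fun t : ℝ => u t * E t := by
      filter_upwards [hae, hE.ae_ne_zero] with t ht hEt
      rw [ht]
      simp only [q]
      field_simp
    have hfc := hf.continuous
    have hEc := hE.1.continuous
    have := (Continuous.ae_eq_iff_eq volume (by fun_prop) (by fun_prop)).1 h1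
    exact fun t => congrFun this t

theorem cauchyInt_congr {φ ψ : ℝ → ℂ} (h : φ =ᵐ[volume] ψ) (z : ℂ) :
    cauchyInt φ z = cauchyInt ψ z :=
  integral_congr_ae (h.mono fun t ht => by simp only [ht])

/-- Cauchy's formula for the quotients `f / E`. -/
theorem IsHermiteBiehler.cauchyInt_eq {E f : ℂ → ℂ} (hE : IsHermiteBiehler E)
    (hf : f ∈ space E) :
    (∀ z : ℂ, 0 < z.im → cauchyInt (fun t => f t / E t) z = 2 * Real.pi * I * (f z / E z)) ∧
      ∀ z : ℂ, z.im < 0 → cauchyInt (fun t => f t / E t) z = 0 := by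
  obtain ⟨hfd, hL, ⟨hbt, hmt⟩, -⟩ := mem_space_iff.1 hf
  obtain ⟨u, huc, huE, hae, -⟩ := hE.exists_continuous_quotient hfd hL
  obtain ⟨A, hA, hgr⟩ := hbt.exists_growth
  have hud : DifferentiableOn ℂ u upperHalf := (hE.differentiableOn_div hfd).congr huE
  have := cauchyInt_eq_of_growth huc hud ((memLp_congr_ae hae).2 hL) hA
    (fun z hz => by rw [huE hz]; exact hgr z hz) (fun ε hε => by
      filter_upwards [meanType_nonpos_iff.1 hmt ε hε, eventually_gt_atTop 0] with y hy hy0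
      rwa [huE (I_mul_mem_upperHalf hy0)])
  refine ⟨fun z hz => ?_, fun z hz => ?_⟩
  · rw [← cauchyInt_congr hae, this.1 z hz, huE hz]
  · rw [← cauchyInt_congr hae, this.2 z hz]

/-- The difference of the Cauchy kernels at `z` and `z̄` is `2i` times the Poisson kernel, so a
Cauchy integral vanishing at `z̄` is a Poisson integral. -/
theorem div_sub_div_conj {z : ℂ} (hz : 0 < z.im) (a : ℂ) (t : ℝ) :
    a / ((t : ℂ) - z) - a / ((t : ℂ) - conj z) =
      2 * z.im * I * (a * (((normSq ((t : ℂ) - z))⁻¹ : ℝ) : ℂ)) := by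
  have e1 : (((normSq ((t : ℂ) - z))⁻¹ : ℝ) : ℂ) = (((t : ℂ) - conj z) * ((t : ℂ) - z))⁻¹ := by
    rw [ofReal_inv, normSq_eq_conj_mul_self, map_sub, conj_ofReal]
  have h1 := ofReal_sub_ne_zero hz.ne' t
  have h2 : (t : ℂ) - conj z ≠ 0 := ofReal_sub_ne_zero (by simpa using hz.ne') t
  rw [e1, div_sub_div _ _ h1 h2, div_eq_mul_inv, mul_comm ((t : ℂ) - z)]
  have h3 : z - conj z = 2 * z.im * I := by rw [sub_conj]; push_cast; ring
  rw [← mul_assoc (2 * (z.im : ℂ) * I), ← h3]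
  ring

/-- A Cauchy integral of a square integrable function that vanishes in the lower half-plane is of
bounded type and nonpositive mean type in the upper half-plane. -/
theorem isSmirnov_of_cauchyInt {v : ℝ → ℂ} {G : ℂ → ℂ} (hv : MemLp v 2)
    (hG : DifferentiableOn ℂ G upperHalf)
    (h1 : ∀ z : ℂ, 0 < z.im → cauchyInt v z = 2 * Real.pi * I * G z)
    (h0 : ∀ z : ℂ, z.im < 0 → cauchyInt v z = 0) : IsSmirnov G := by
  have hp : ‖(2 * Real.pi * I : ℂ)‖ = 2 * Real.pi := by simp [abs_of_pos Real.pi_pos]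
  have hva : MemLp (fun t => (‖v t‖ : ℂ)) 2 :=
    hv.of_le (continuous_ofReal.comp_aestronglyMeasurable hv.1.norm)
      (Eventually.of_forall fun t => by simp)
  -- `Re N` is the unnormalized Poisson integral of `|v|`, so `|G| ≤ Re N` and `|1 + N| ≥ 1 + Re N`.
  -- Hence `G/(1 + N)` and `1/(1 + N)` are bounded, and `G` is their quotient.
  set N : ℂ → ℂ := fun z => -I * cauchyInt (fun t => (‖v t‖ : ℂ)) z
  have hNd : DifferentiableOn ℂ N upperHalf := fun z (hz : 0 < z.im) =>
    ((differentiableAt_cauchyInt hva hz.ne').const_mul _).differentiableWithinAt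
  have hNG : ∀ z : ℂ, 0 < z.im → ‖G z‖ ≤ (N z).re := by
    intro z hz
    have hzc : (conj z).im < 0 := by simpa using hz
    have hiv := integrable_div_ofReal_sub hv hz.ne'
    have hivc := integrable_div_ofReal_sub hv hzc.ne
    have hia := integrable_div_ofReal_sub hva hz.ne'
    have hre : (N z).re = ∫ t : ℝ, z.im * (‖v t‖ * (normSq ((t : ℂ) - z))⁻¹) := by
      have : (N z).re = (cauchyInt (fun t => (‖v t‖ : ℂ)) z).im := by simp [N]
      rw [this, cauchyInt]
      have h2 := imCLM.integral_comp_comm hia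
      simp only [imCLM_apply] at h2
      rw [← h2]
      refine integral_congr_ae (Eventually.of_forall fun t => ?_)
      simp only [div_eq_mul_inv, im_ofReal_mul, inv_im]
      simp
      ring
    have hrint : Integrable fun t : ℝ => z.im * (‖v t‖ * (normSq ((t : ℂ) - z))⁻¹) := by
      refine hia.im.congr (Eventually.of_forall fun t => ?_)
      simp only [div_eq_mul_inv, RCLike.im_to_complex, im_ofReal_mul, inv_im]
      simp
      ring
    have h3 : 2 * Real.pi * I * G z =
        ∫ t : ℝ, 2 * z.im * I * (v t * (((normSq ((t : ℂ) - z))⁻¹ : ℝ) : ℂ)) := by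
      have h4 := integral_sub hiv hivc
      simp_rw [div_sub_div_conj hz] at h4
      rw [h4, ← cauchyInt, ← cauchyInt, h1 z hz, h0 _ hzc, sub_zero]
    have h5 : 2 * Real.pi * ‖G z‖ ≤ 2 * (N z).re := by
      rw [← hp, ← norm_mul, h3, hre, ← integral_const_mul]
      refine norm_integral_le_of_norm_le (hrint.const_mul 2) (Eventually.of_forall fun t => ?_)
      rw [norm_mul, norm_mul, norm_mul, norm_mul, norm_real, norm_real, norm_I,
        Real.norm_of_nonneg hz.le, Real.norm_of_nonneg (inv_nonneg.2 (normSq_nonneg _))]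
      simp only [Complex.norm_ofNat]
      exact le_of_eq (by ring)
    nlinarith [Real.pi_gt_three, norm_nonneg (G z)]
  have hre1 : ∀ z : ℂ, 0 < z.im → 1 + (N z).re ≤ ‖1 + N z‖ := by
    intro z hz
    have := re_le_norm (1 + N z)
    simpa using this
  have hpos : ∀ z : ℂ, 0 < z.im → 0 < ‖1 + N z‖ := by
    intro z hz
    have := hre1 z hz
    linarith [(norm_nonneg _).trans (hNG z hz)]
  have hne : ∀ z ∈ upperHalf, 1 + N z ≠ 0 := fun z hz => norm_pos_iff.1 (hpos z hz)
  refine ⟨⟨hG, fun z => G z / (1 + N z), fun z => 1 / (1 + N z), hG.div (by fun_prop) hne,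
    DifferentiableOn.div (by fun_prop) (by fun_prop) hne, ⟨1, fun z hz => ?_⟩, ⟨1, fun z hz => ?_⟩,
    ⟨I, by show 0 < I.im; simp, one_div_ne_zero (hne I (by show 0 < I.im; simp))⟩, fun z hz => ?_⟩, ?_⟩
  · rw [norm_div]
    refine div_le_one_of_le₀ ?_ (norm_nonneg _)
    linarith [hNG z hz, hre1 z hz]
  · rw [norm_div, norm_one]
    refine div_le_one_of_le₀ ?_ (norm_nonneg _)
    linarith [(norm_nonneg _).trans (hNG z hz), hre1 z hz]
  · simp only; ring
  · rw [meanType_nonpos_iff]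
    intro ε hε
    have hlarge := (Real.tendsto_exp_atTop.comp
      (tendsto_id.const_mul_atTop hε)).eventually_ge_atTop ((∫ t : ℝ, ‖v t‖ ^ 2) + Real.pi)
    filter_upwards [hlarge, eventually_ge_atTop 1] with y hy hy1
    have him : (I * (y : ℂ)).im = y := by simp
    have h2 := norm_cauchyInt_le hv (z := I * y) (by rw [him]; linarith)
    rw [h1 _ (by rw [him]; linarith), norm_mul, hp, him] at h2
    have h3 : Real.pi / y ≤ Real.pi := div_le_self Real.pi_pos.le hy1
    refine le_trans ?_ hy
    nlinarith [Real.pi_gt_three, norm_nonneg (G (I * y))]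

end DeBranges
end

/-! ### The kernels and their membership in the space. -/

noncomputable section
namespace DeBranges
open Complex Metric Set Filter Topology MeasureTheory

theorem kernelNum_conj (E : ℂ → ℂ) (w : ℂ) : kernelNum E w (conj w) = 0 := by
  simp [kernelNum, starFn, mul_comm]

/-- As a divided difference of an entire function, the kernel is entire, with the removable
singularity accounted for. -/
theorem kernel_eq_dslope (E : ℂ → ℂ) (w : ℂ) :
    kernel E w = fun z => -dslope (kernelNum E w) (conj w) z / (2 * (Real.pi : ℂ) * I) := by
  ext z
  unfold kernel
  split_ifs with h
  · rw [h, dslope_same]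
  · have h1 : z - conj w ≠ 0 := sub_ne_zero.2 h
    rw [dslope_of_ne _ h, slope_def_field, kernelNum_conj, sub_zero, ← neg_sub z, mul_neg, div_neg,
      neg_div, div_div, mul_comm (z - conj w)]

theorem differentiable_kernelNum {E : ℂ → ℂ} (hE : Differentiable ℂ E) (w : ℂ) :
    Differentiable ℂ (kernelNum E w) :=
  (hE.const_mul _).sub ((differentiable_starFn hE).const_mul _)

theorem differentiable_kernel {E : ℂ → ℂ} (hE : Differentiable ℂ E) (w : ℂ) :
    Differentiable ℂ (kernel E w) := by
  rw [kernel_eq_dslope]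
  have : Differentiable ℂ (dslope (kernelNum E w) (conj w)) := by
    rw [← differentiableOn_univ]
    exact (Complex.differentiableOn_dslope univ_mem).2 (differentiable_kernelNum hE w).differentiableOn
  exact this.neg.div_const _

theorem kernel_of_ne {E : ℂ → ℂ} {w z : ℂ} (h : z ≠ conj w) :
    kernel E w z = kernelNum E w z / (2 * (Real.pi : ℂ) * I * (conj w - z)) := if_neg h

theorem eq_of_eqOn_ne {f g : ℂ → ℂ} (hf : Differentiable ℂ f) (hg : Differentiable ℂ g) (a : ℂ)
    (h : ∀ z, z ≠ a → f z = g z) : f = g :=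
  hf.continuous.ext_on (dense_compl_singleton a) hg.continuous fun z hz => h z hz

theorem starFn_kernel {E : ℂ → ℂ} (hE : Differentiable ℂ E) (w : ℂ) :
    starFn (kernel E w) = kernel E (conj w) := by
  refine eq_of_eqOn_ne (differentiable_starFn (differentiable_kernel hE w))
    (differentiable_kernel hE _) w fun z hz => ?_
  have h1 : conj z ≠ conj w := fun h => hz (by simpa using congrArg conj h)
  rw [starFn, kernel_of_ne h1, kernel_of_ne (by simpa using hz)]
  have h2 : w - z ≠ 0 := sub_ne_zero.2 (Ne.symm hz)
  simp only [kernelNum, starFn, map_div₀, map_sub, map_mul, conj_conj, conj_I, conj_ofReal,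
    map_ofNat]
  have hpi : (Real.pi : ℂ) ≠ 0 := by exact_mod_cast Real.pi_ne_zero
  field_simp
  ring

/-- Add and subtract `conj(F(w)) F(z) E(w̄) E*(z)` in the numerator of `K_EF`; the point `z = w̄`
follows by continuity. -/
theorem kernel_mul_identity {E F : ℂ → ℂ} (hE : Differentiable ℂ E) (hF : Differentiable ℂ F)
    (w : ℂ) : kernel (E * F) w =
      conj (F w) • mapI F (kernel E w) + E (conj w) • mapJ E (kernel F w) := by
  refine eq_of_eqOn_ne (differentiable_kernel (hE.mul hF) w) ?_ (conj w) fun z hz => ?_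
  · exact (((differentiable_kernel hE w).mul hF).const_smul _).add
      (((differentiable_kernel hF w).mul (differentiable_starFn hE)).const_smul _)
  · simp only [Pi.add_apply, Pi.smul_apply, mapI, mapJ, kernel_of_ne hz, kernelNum, starFn,
      Pi.mul_apply, smul_eq_mul, map_mul]
    ring

theorem aestronglyMeasurable_div {E f : ℂ → ℂ} (hE : Differentiable ℂ E)
    (hf : Differentiable ℂ f) :
    AEStronglyMeasurable (fun t : ℝ => f t / E t) volume :=
  ((hf.continuous.comp continuous_ofReal).measurable.div
    (hE.continuous.comp continuous_ofReal).measurable).aestronglyMeasurable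

theorem norm_kernelNum_div_ofReal_le (E : ℂ → ℂ) (w : ℂ) (t : ℝ) :
    ‖kernelNum E w t‖ / ‖E t‖ ≤ ‖E w‖ + ‖E (conj w)‖ := by
  refine div_le_of_le_mul₀ (norm_nonneg _) (by positivity) ?_
  refine (norm_sub_le _ _).trans_eq ?_
  rw [norm_mul, norm_mul, starFn_ofReal, RCLike.norm_conj, RCLike.norm_conj]
  ring

theorem norm_kernel_div_ofReal_le {E : ℂ → ℂ} {w : ℂ} {t : ℝ} (h : (t : ℂ) ≠ conj w) :
    ‖kernel E w t / E t‖ ≤ (‖E w‖ + ‖E (conj w)‖) * ‖((t : ℂ) - conj w)⁻¹‖ := by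
  have hn : ‖(2 * (Real.pi : ℂ) * I)‖ = 2 * Real.pi := by simp [abs_of_pos Real.pi_pos]
  have h1 := norm_kernelNum_div_ofReal_le E w t
  have h2 : 0 < ‖(t : ℂ) - conj w‖ := norm_pos_iff.2 (sub_ne_zero.2 h)
  rw [kernel_of_ne h, div_right_comm, norm_div, norm_div, norm_mul _ (conj w - _), hn,
    norm_sub_rev (conj w), norm_inv, ← div_eq_mul_inv]
  have h3 : 0 ≤ ‖kernelNum E w t‖ / ‖E t‖ := by positivity
  gcongr
  nlinarith [Real.pi_gt_three]

theorem isSmirnov_kernel_div {E : ℂ → ℂ} (hE : IsHermiteBiehler E) (w : ℂ) :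
    IsSmirnov fun z => kernel E w z / E z := by
  have hpi : (2 * (Real.pi : ℂ) * I) ≠ 0 := two_pi_I_ne_zero
  have hn : ‖(2 * (Real.pi : ℂ) * I)‖ = 2 * Real.pi := by simp [abs_of_pos Real.pi_pos]
  set C := ‖E w‖ + ‖E (conj w)‖
  have hnum : ∀ z ∈ upperHalf, ‖kernelNum E w z / E z‖ ≤ C := by
    intro z hz
    have hE0 := hE.ne_zero hz
    have : kernelNum E w z / E z = conj (E w) - E (conj w) * (starFn E z / E z) := by
      rw [kernelNum]; field_simp
    rw [this]
    refine (norm_sub_le _ _).trans ?_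
    rw [norm_mul, RCLike.norm_conj]
    have := mul_le_of_le_one_right (norm_nonneg (E (conj w))) (hE.norm_starFn_div_le hz)
    linarith
  have hI : ∀ z ∈ upperHalf, 1 ≤ ‖z + I‖ := by
    intro z hz
    have hz' : 0 < z.im := hz
    have := (le_abs_self _).trans (abs_im_le_norm (z + I))
    simp at this
    linarith
  have hI0 : ∀ z ∈ upperHalf, z + I ≠ 0 := fun z hz =>
    norm_pos_iff.1 (lt_of_lt_of_le one_pos (hI z hz))
  -- Numerator and denominator are both divided by `z + i`, of modulus at least 1 in `ℂ⁺`, to make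
  -- `w̄ - z` bounded.
  refine ⟨⟨hE.differentiableOn_div (differentiable_kernel hE.1 w),
    fun z => kernelNum E w z / E z / (2 * (Real.pi : ℂ) * I * (z + I)),
    fun z => (conj w - z) / (z + I),
    (hE.differentiableOn_div (differentiable_kernelNum hE.1 w)).div (by fun_prop)
      fun z hz => mul_ne_zero hpi (hI0 z hz),
    DifferentiableOn.div (by fun_prop) (by fun_prop) hI0, ⟨C, fun z hz => ?_⟩,
    ⟨‖w‖ + 2, fun z hz => ?_⟩, ?_, fun z hz => ?_⟩, ?_⟩
  · rw [norm_div, norm_mul, hn]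
    have h1 := hI z hz
    refine (div_le_self (norm_nonneg _) ?_).trans (hnum z hz)
    nlinarith [Real.pi_gt_three]
  · rw [norm_div]
    have h1 := hI z hz
    rw [div_le_iff₀ (by linarith)]
    have h2 : ‖conj w - z‖ ≤ ‖conj w + I‖ + ‖z + I‖ := by
      rw [show conj w - z = (conj w + I) - (z + I) by ring]
      exact norm_sub_le _ _
    have h3 := norm_add_le (conj w) I
    rw [RCLike.norm_conj, norm_I] at h3
    nlinarith [norm_nonneg w]
  · by_cases h : conj w = I
    · refine ⟨2 * I, by show 0 < (2 * I).im; simp, div_ne_zero ?_ (hI0 _ (by show 0 < (2 * I).im; simp))⟩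
      rw [h, show I - 2 * I = -I by ring]
      simp
    · exact ⟨I, by show 0 < I.im; simp, div_ne_zero (sub_ne_zero.2 h)
        (hI0 _ (by show 0 < I.im; simp))⟩
  · have h0 := hI0 z hz
    have hE0 := hE.ne_zero hz
    simp only
    by_cases h : z = conj w
    · rw [h, sub_self, zero_div, mul_zero, kernelNum_conj, zero_div, zero_div]
    · have h1 : conj w - z ≠ 0 := sub_ne_zero.2 (Ne.symm h)
      rw [kernel_of_ne h]
      field_simp
  · rw [meanType_nonpos_iff]
    intro ε hε
    have hlarge := (Real.tendsto_exp_atTop.comp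
      (tendsto_id.const_mul_atTop hε)).eventually_ge_atTop C
    filter_upwards [hlarge, eventually_ge_atTop (‖w‖ + 1)] with y hy hy1
    have hy0 : 0 < y := by linarith [norm_nonneg w]
    have hU := I_mul_mem_upperHalf hy0
    have hd : 1 ≤ ‖conj w - I * y‖ := by
      have := norm_sub_norm_le (I * (y : ℂ)) (conj w)
      rw [norm_mul, norm_I, norm_real, RCLike.norm_conj, Real.norm_of_nonneg hy0.le,
        norm_sub_rev] at this
      linarith
    have hne : I * (y : ℂ) ≠ conj w := by
      intro h
      rw [h, sub_self, norm_zero] at hd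
      linarith
    rw [kernel_of_ne hne, div_right_comm, norm_div, norm_mul, hn]
    refine (div_le_self (norm_nonneg _) ?_).trans ((hnum _ hU).trans hy)
    nlinarith [Real.pi_gt_three]

theorem exists_bound_lipschitz {E : ℂ → ℂ} (hE : Differentiable ℂ E) (R : ℝ) :
    ∃ M L : ℝ, 0 ≤ M ∧ 0 ≤ L ∧ (∀ z ∈ closedBall (0 : ℂ) R, ‖E z‖ ≤ M) ∧
      ∀ z ∈ closedBall (0 : ℂ) R, ∀ z' ∈ closedBall (0 : ℂ) R, ‖E z - E z'‖ ≤ L * ‖z - z'‖ := by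
  have hc := isCompact_closedBall (0 : ℂ) R
  have hd : Continuous (deriv E) := (hE.contDiff (n := 1)).continuous_deriv le_rfl
  obtain ⟨M, hM⟩ := hc.exists_bound_of_continuousOn hE.continuous.continuousOn
  obtain ⟨L, hL⟩ := hc.exists_bound_of_continuousOn hd.continuousOn
  refine ⟨|M|, |L|, abs_nonneg _, abs_nonneg _, fun z hz => (hM z hz).trans (le_abs_self _),
    fun z hz z' hz' => ?_⟩
  exact (convex_closedBall (0 : ℂ) R).norm_image_sub_le_of_norm_deriv_le
    (fun x _ => hE x) (fun x hx => (hL x hx).trans (le_abs_self _)) hz' hz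

/-- The kernel is locally bounded jointly in both variables, off the antidiagonal. -/
theorem exists_kernel_bound {E : ℂ → ℂ} (hE : Differentiable ℂ E) (R : ℝ) :
    ∃ B : ℝ, 0 ≤ B ∧ ∀ w ∈ closedBall (0 : ℂ) R, ∀ z ∈ closedBall (0 : ℂ) R, z ≠ conj w →
      ‖kernel E w z‖ ≤ B := by
  obtain ⟨M, L, hM0, hL0, hM, hL⟩ := exists_bound_lipschitz hE R
  have hconj : ∀ z ∈ closedBall (0 : ℂ) R, conj z ∈ closedBall (0 : ℂ) R := by
    intro z hz
    simpa using hz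
  have hn : ‖(2 * (Real.pi : ℂ) * I)‖ = 2 * Real.pi := by simp [abs_of_pos Real.pi_pos]
  refine ⟨M * L, by positivity, fun w hw z hz hne => ?_⟩
  have hpos : 0 < ‖conj w - z‖ := norm_pos_iff.2 (sub_ne_zero.2 (Ne.symm hne))
  -- The numerator as a combination of two increments of `E`, each over a distance `|w̄ - z|`.
  have h1 : kernelNum E w z =
      conj (E w) * (E z - E (conj w)) - E (conj w) * conj (E (conj z) - E w) := by
    simp only [kernelNum, starFn, map_sub]; ring
  have h2 : ‖kernelNum E w z‖ ≤ 2 * (M * L) * ‖conj w - z‖ := by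
    rw [h1]
    refine (norm_sub_le _ _).trans ?_
    rw [norm_mul, norm_mul, RCLike.norm_conj, RCLike.norm_conj]
    have e1 := hL z hz (conj w) (hconj w hw)
    have e2 := hL (conj z) (hconj z hz) w hw
    have e3 : ‖conj z - w‖ = ‖conj w - z‖ := by
      rw [← RCLike.norm_conj, map_sub, conj_conj, norm_sub_rev]
    rw [norm_sub_rev z] at e1
    rw [e3] at e2
    calc _ ≤ M * (L * ‖conj w - z‖) + M * (L * ‖conj w - z‖) := by
          gcongr
          exacts [hM w hw, hM _ (hconj w hw)]
      _ = _ := by ring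
  rw [kernel_of_ne hne, norm_div, norm_mul _ (conj w - z), hn, div_le_iff₀ (by positivity)]
  refine h2.trans ?_
  have h3 : 0 ≤ M * L * ‖conj w - z‖ := by positivity
  nlinarith [Real.pi_gt_three]

/-- Uniform domination of the kernels at points approaching a real point vertically. -/
theorem exists_kernel_dominated {E : ℂ → ℂ} (hE : Differentiable ℂ E) {x : ℝ}
    (hx : E x ≠ 0) :
    ∃ D : ℝ, 0 ≤ D ∧ ∀ η ∈ Icc (0 : ℝ) 1, ∀ t : ℝ, t ≠ x →
      ‖kernel E (x + η * I) t / E t‖ ≤ D * ‖((t : ℂ) - (x + I))⁻¹‖ := by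
  obtain ⟨δ, hδ, hδE⟩ : ∃ δ > 0, ∀ t : ℝ, |t - x| < δ → ‖E x‖ / 2 < ‖E t‖ := by
    have hc : Continuous fun t : ℝ => ‖E t‖ := by
      have := hE.continuous
      fun_prop
    have h1 : ∀ᶠ t in 𝓝 x, ‖E x‖ / 2 < ‖E (t : ℝ)‖ :=
      hc.continuousAt.eventually (lt_mem_nhds (half_lt_self (norm_pos_iff.2 hx)))
    obtain ⟨δ, hδ, h2⟩ := Metric.eventually_nhds_iff.1 h1
    exact ⟨δ, hδ, fun t ht => h2 (by rwa [Real.dist_eq])⟩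
  have hx0 : 0 < ‖E x‖ := norm_pos_iff.2 hx
  set R := |x| + δ + 2
  obtain ⟨M, -, hM0, -, hM, -⟩ := exists_bound_lipschitz hE R
  obtain ⟨B, hB0, hB⟩ := exists_kernel_bound hE R
  have hw : ∀ η ∈ Icc (0 : ℝ) 1, ‖(x : ℂ) + η * I‖ ≤ R := by
    intro η hη
    have := norm_add_le (x : ℂ) (η * I)
    rw [norm_mul, norm_I, norm_real, norm_real, Real.norm_eq_abs, Real.norm_of_nonneg hη.1] at this
    linarith [hη.2]
  refine ⟨B / (‖E x‖ / 2) * (δ + 1) + 2 * M * (1 + 1 / δ), by positivity, fun η hη t htx => ?_⟩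
  have hwc : conj ((x : ℂ) + η * I) = x - η * I := by simp [sub_eq_add_neg]
  have hre : |t - x| ≤ ‖(t : ℂ) - conj (x + η * I)‖ := by
    have := abs_re_le_norm ((t : ℂ) - conj (x + η * I))
    simpa using this
  have htx' : 0 < |t - x| := abs_pos.2 (sub_ne_zero.2 htx)
  have hne : (t : ℂ) ≠ conj (x + η * I) := by
    intro h
    rw [h, sub_self, norm_zero] at hre
    linarith
  have hq : ‖(t : ℂ) - (x + I)‖ ≤ |t - x| + 1 := by
    rw [← sub_sub, ← ofReal_sub]
    refine (norm_sub_le _ _).trans_eq ?_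
    rw [norm_real, norm_I, Real.norm_eq_abs]
  have hq0 : 0 < ‖(t : ℂ) - (x + I)‖ := by
    have := abs_im_le_norm ((t : ℂ) - (x + I))
    simp at this
    linarith
  rw [norm_inv, ← div_eq_mul_inv, le_div_iff₀ hq0]
  have hwR := hw η hη
  -- Near `x` the kernel is locally bounded and `|E(t)| > |E(x)|/2`; away from `x` the explicit
  -- bound decays like `1/|t - x|`.
  rcases lt_or_ge |t - x| δ with hlt | hge
  · have h1 : ‖kernel E (x + η * I) t‖ ≤ B := by
      refine hB _ (by simpa using hwR) _ ?_ hne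
      have : |t| ≤ |t - x| + |x| := by simpa using abs_add_le (t - x) x
      simp only [mem_closedBall, dist_zero_right, norm_real, Real.norm_eq_abs, R]
      linarith
    have h2 := hδE t hlt
    rw [norm_div]
    calc ‖kernel E (x + η * I) t‖ / ‖E t‖ * ‖(t : ℂ) - (x + I)‖
        ≤ B / (‖E x‖ / 2) * (δ + 1) := by
          gcongr
          linarith
      _ ≤ _ := le_add_of_nonneg_right (by positivity)
  · have h1 := norm_kernel_div_ofReal_le (E := E) hne
    have h2 : ‖E (x + η * I)‖ + ‖E (conj (x + η * I))‖ ≤ 2 * M := by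
      have e1 := hM (x + η * I) (by simpa using hwR)
      have e2 := hM (conj (x + η * I)) (by rw [mem_closedBall_zero_iff, RCLike.norm_conj]; exact hwR)
      linarith
    have h3 : ‖(t : ℂ) - (x + I)‖ ≤ (1 + 1 / δ) * |t - x| := by
      have : 1 ≤ |t - x| / δ := (one_le_div hδ).2 hge
      have e : (1 + 1 / δ) * |t - x| = |t - x| + |t - x| / δ := by ring
      linarith
    have h4 : ‖((t : ℂ) - conj (x + η * I))⁻¹‖ ≤ |t - x|⁻¹ := by
      rw [norm_inv]
      gcongr
    calc _ ≤ (2 * M * |t - x|⁻¹) * ((1 + 1 / δ) * |t - x|) := by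
          gcongr
          refine h1.trans ?_
          gcongr
      _ = 2 * M * (1 + 1 / δ) := by field_simp
      _ ≤ _ := le_add_of_nonneg_left (by positivity)

theorem kernel_eq_zero_of_real_zero {E : ℂ → ℂ} {x : ℝ} (hx : E x = 0) :
    kernel E x = 0 := by
  have : kernelNum E (x : ℂ) = 0 := by
    ext z
    simp [kernelNum, hx]
  ext z
  simp [kernel, this]

/-- Off the real axis the explicit bound suffices. At a real `w` the singularity on the line is
absorbed by `exists_kernel_dominated` with `η = 0` when `E(w) ≠ 0`, and the kernel vanishes
identically when `E(w) = 0`. -/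
theorem memLp_kernel_div {E : ℂ → ℂ} (hE : Differentiable ℂ E) (w : ℂ) :
    MemLp (fun t : ℝ => kernel E w t / E t) 2 := by
  have hm := aestronglyMeasurable_div hE (differentiable_kernel hE w)
  by_cases hw : w.im = 0
  · have hwr : w = (w.re : ℂ) := Complex.ext rfl (by simpa using hw)
    by_cases h0 : E w = 0
    · rw [hwr, kernel_eq_zero_of_real_zero (by rw [← hwr]; exact h0)]
      simp
    · obtain ⟨D, hD0, hD⟩ := exists_kernel_dominated hE (x := w.re) (by rw [← hwr]; exact h0)
      refine ((memLp_inv_ofReal_sub (z := w.re + I) (by simp)).const_mul (D : ℂ)).of_le hm ?_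
      have hne : ∀ᵐ t : ℝ, t ≠ w.re := by
        simp [ae_iff]
      filter_upwards [hne] with t ht
      have := hD 0 (by simp) t ht
      rw [norm_mul, norm_real, Real.norm_of_nonneg hD0]
      simpa [← hwr] using this
  · have hwc : (conj w).im ≠ 0 := by simpa using hw
    refine ((memLp_inv_ofReal_sub hwc).const_mul
      ((‖E w‖ + ‖E (conj w)‖ : ℝ) : ℂ)).of_le hm (Eventually.of_forall fun t => ?_)
    rw [norm_mul, norm_real, Real.norm_of_nonneg (by positivity)]
    exact norm_kernel_div_ofReal_le (sub_ne_zero.1 (ofReal_sub_ne_zero hwc t))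

theorem kernel_mem_space {E : ℂ → ℂ} (hE : IsHermiteBiehler E) (w : ℂ) :
    kernel E w ∈ space E := by
  rw [mem_space_iff]
  refine ⟨differentiable_kernel hE.1 w, memLp_kernel_div hE.1 w, isSmirnov_kernel_div hE w, ?_⟩
  rw [starFn_kernel hE.1]
  exact isSmirnov_kernel_div hE _

/-! ### The reproducing property. -/

theorem ip_eq_integral (E f g : ℂ → ℂ) :
    ip E f g = ∫ t : ℝ, f t / E t * conj (g t / E t) := by
  refine integral_congr_ae (Eventually.of_forall fun t => ?_)
  simp only
  rw [map_div₀, div_mul_div_comm, mul_conj, normSq_eq_norm_sq]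

theorem cauchyInt_conj (φ : ℝ → ℂ) (z : ℂ) :
    cauchyInt (fun t => conj (φ t)) z = conj (cauchyInt φ (conj z)) := by
  rw [cauchyInt, cauchyInt, ← integral_conj]
  refine integral_congr_ae (Eventually.of_forall fun t => ?_)
  simp

/-- On the line `f* = conj f`, so `⟨f, K_w⟩` splits into Cauchy integrals of `f/E` at `w` and of
`f*/E` at `w̄`. One of these points lies in the lower half-plane and contributes zero; the other
gives `f(w)`. -/
theorem reproducing_of_im_ne_zero {E f : ℂ → ℂ} (hE : IsHermiteBiehler E) (hf : f ∈ space E)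
    {w : ℂ} (hw : w.im ≠ 0) : f w = ip E f (kernel E w) := by
  have hpi : (2 * (Real.pi : ℂ) * I) ≠ 0 := two_pi_I_ne_zero
  have hfs := starFn_mem_space hE.1 hf
  have hL := (mem_space_iff.1 hf).2.1
  have hLs := (mem_space_iff.1 hfs).2.1
  have hLc : MemLp (fun t : ℝ => conj (starFn f t / E t)) 2 := hLs.star
  have hi1 := integrable_div_ofReal_sub hL hw
  have hi2 := integrable_div_ofReal_sub hLc hw
  have hwc : (conj w).im ≠ 0 := by simpa using hw
  have key : ip E f (kernel E w) = (2 * (Real.pi : ℂ) * I)⁻¹ *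
      (E w * cauchyInt (fun t => f t / E t) w -
        starFn E w * conj (cauchyInt (fun t => starFn f t / E t) (conj w))) := by
    rw [← cauchyInt_conj, ip_eq_integral, cauchyInt, cauchyInt, ← integral_const_mul,
      ← integral_const_mul, ← integral_sub (hi1.const_mul _) (hi2.const_mul _),
      ← integral_const_mul]
    refine integral_congr_ae ?_
    filter_upwards [hE.ae_ne_zero] with t ht
    have hne : (t : ℂ) ≠ conj w := sub_ne_zero.1 (ofReal_sub_ne_zero hwc t)
    have h1 := ofReal_sub_ne_zero hw t
    have h2 : w - t ≠ 0 := sub_ne_zero.2 (Ne.symm (sub_ne_zero.1 h1))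
    have h3 : conj (E t) ≠ 0 := by simpa using ht
    simp only [kernel_of_ne hne, kernelNum, starFn, map_div₀, map_sub, map_mul, conj_conj, conj_I,
      conj_ofReal, map_ofNat]
    field_simp
    ring
  obtain ⟨c1, c2⟩ := hE.cauchyInt_eq hf
  obtain ⟨d1, d2⟩ := hE.cauchyInt_eq hfs
  rcases lt_or_gt_of_ne hw with hneg | hpos
  · have hwc' : 0 < (conj w).im := by simpa using hneg
    have hE0 := hE.ne_zero hwc'
    have hE1 : conj (E (conj w)) ≠ 0 := by simpa using hE0
    rw [key, c2 w hneg, d1 _ hwc']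
    simp only [starFn, map_div₀, map_mul, conj_conj, conj_I, conj_ofReal, map_ofNat]
    field_simp
    ring
  · have hE0 := hE.ne_zero hpos
    rw [key, c1 w hpos, d2 _ (by simpa using hpos)]
    simp only [map_zero, mul_zero, sub_zero]
    field_simp

/-- If `E(x) = 0`, both sides vanish. Otherwise let `η → 0` in the formula at `x + iη`, by dominated
convergence. -/
theorem reproducing_real {E f : ℂ → ℂ} (hE : IsHermiteBiehler E) (hf : f ∈ space E)
    (x : ℝ) : f x = ip E f (kernel E x) := by
  obtain ⟨hfd, hL, -⟩ := mem_space_iff.1 hf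
  by_cases h0 : E x = 0
  · obtain ⟨u, -, -, -, hu⟩ := hE.exists_continuous_quotient hfd hL
    rw [hu x, h0, mul_zero, kernel_eq_zero_of_real_zero h0]
    simp [ip]
  obtain ⟨D, hD0, hD⟩ := exists_kernel_dominated hE.1 h0
  have hleft : Tendsto (fun η : ℝ => f (x + η * I)) (𝓝[>] 0) (𝓝 (f x)) := by
    have hfc := hfd.continuous
    have : Continuous fun η : ℝ => f (x + η * I) := by fun_prop
    have h := (this.tendsto 0).mono_left (nhdsWithin_le_nhds (s := Ioi 0))
    simpa using h
  have hright : Tendsto (fun η : ℝ => ip E f (kernel E (x + η * I))) (𝓝[>] 0)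
      (𝓝 (ip E f (kernel E x))) := by
    simp_rw [ip_eq_integral]
    refine tendsto_integral_filter_of_dominated_convergence
      (fun t => D * ‖f t / E t * ((t : ℂ) - (x + I))⁻¹‖) ?_ ?_ ?_ ?_
    · exact Eventually.of_forall fun η => hL.1.mul
        (memLp_kernel_div hE.1 _).star.1
    · have hη : ∀ᶠ η : ℝ in 𝓝[>] 0, η ∈ Icc (0 : ℝ) 1 :=
        mem_of_superset (Ioo_mem_nhdsGT one_pos) Ioo_subset_Icc_self
      filter_upwards [hη] with η hη
      have hne : ∀ᵐ t : ℝ, t ≠ x := by simp [ae_iff]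
      filter_upwards [hne] with t ht
      rw [norm_mul, norm_mul, RCLike.norm_conj, mul_left_comm]
      gcongr
      exact hD η hη t ht
    · exact (hL.integrable_mul (memLp_inv_ofReal_sub (z := x + I) (by simp))).norm.const_mul D
    · have hne : ∀ᵐ t : ℝ, t ≠ x := by simp [ae_iff]
      filter_upwards [hne] with t ht
      refine Tendsto.const_mul _ ?_
      have hk : ∀ η : ℝ, kernel E (x + η * I) t = kernelNum E (x + η * I) t /
          (2 * (Real.pi : ℂ) * I * (conj ((x : ℂ) + η * I) - t)) := by
        intro η
        refine kernel_of_ne fun h => ht ?_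
        simpa using congrArg re h
      have hEc := hE.1.continuous
      have hcont : ContinuousAt (fun η : ℝ => conj (kernel E (x + η * I) t / E t)) 0 := by
        simp_rw [hk]
        refine continuous_conj.continuousAt.comp (ContinuousAt.div_const (ContinuousAt.div ?_ ?_ ?_) _)
        · refine Continuous.continuousAt ?_
          unfold kernelNum
          fun_prop
        · fun_prop
        · refine mul_ne_zero two_pi_I_ne_zero ?_
          simp only [ofReal_zero, zero_mul, add_zero, conj_ofReal]
          rw [← ofReal_sub]
          exact_mod_cast sub_ne_zero.2 (Ne.symm ht)
      have h := hcont.tendsto.mono_left (nhdsWithin_le_nhds (s := Ioi 0))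
      simpa using h
  refine tendsto_nhds_unique hleft (hright.congr' ?_)
  filter_upwards [self_mem_nhdsWithin] with η hη
  have hη' : 0 < η := hη
  exact (reproducing_of_im_ne_zero hE hf (by simpa using hη'.ne')).symm

theorem isReproducingKernel_kernel {E : ℂ → ℂ} (hE : IsHermiteBiehler E) :
    IsReproducingKernel E (kernel E) := by
  refine fun w => ⟨kernel_mem_space hE w, fun f hf => ?_⟩
  by_cases hw : w.im = 0
  · have hwr : w = (w.re : ℂ) := Complex.ext rfl (by simpa using hw)
    rw [hwr]
    exact reproducing_real hE hf w.re
  · exact reproducing_of_im_ne_zero hE hf hw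

end DeBranges
end

/-! ### The maps `I` and `J`. -/

noncomputable section
namespace DeBranges
open Complex Metric Set Filter Topology MeasureTheory

section Maps

variable {E F : ℂ → ℂ}

theorem mapI_div_ae (hF : IsHermiteBiehler F) (f : ℂ → ℂ) :
    (fun t : ℝ => mapI F f t / (E * F) t) =ᵐ[volume] fun t : ℝ => f t / E t := by
  filter_upwards [hF.ae_ne_zero] with t ht
  rw [mapI, Pi.mul_apply, mul_div_mul_right _ _ ht]

/-- `fF/(EF) = f/E`, while `(fF)*/(EF) = (f*/E)(F*/F)` has a second factor bounded by 1 in `ℂ⁺`. For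
`J` the roles are exchanged: the bounded factor `E*/E` appears without the star. -/
theorem mapI_mem_space (hF : IsHermiteBiehler F) {f : ℂ → ℂ} (hf : f ∈ space E) :
    mapI F f ∈ space (E * F) := by
  rw [mem_space_iff] at hf ⊢
  refine ⟨hf.1.mul hF.1, (memLp_congr_ae (mapI_div_ae hF f)).2 hf.2.1, hf.2.2.1.congr fun z hz => ?_,
    (hf.2.2.2.mul_bounded (hF.differentiableOn_div (differentiable_starFn hF.1))
      fun z hz => hF.norm_starFn_div_le hz).congr fun z hz => ?_⟩
  · simp only [mapI, Pi.mul_apply, mul_div_mul_right _ _ (hF.ne_zero hz)]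
  · simp only [mapI, Pi.mul_apply, starFn, map_mul, div_mul_div_comm]

theorem ip_mapI (hF : IsHermiteBiehler F) (f₁ f₂ : ℂ → ℂ) :
    ip (E * F) (mapI F f₁) (mapI F f₂) = ip E f₁ f₂ := by
  rw [ip_eq_integral, ip_eq_integral]
  refine integral_congr_ae ?_
  filter_upwards [mapI_div_ae (E := E) hF f₁, mapI_div_ae (E := E) hF f₂] with t h1 h2
  rw [h1, h2]

theorem mapJ_div_ofReal (E F g : ℂ → ℂ) (t : ℝ) :
    mapJ E g t / (E * F) t = g t / F t * (conj (E t) / E t) := by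
  rw [mapJ, Pi.mul_apply, starFn_ofReal, div_mul_div_comm, mul_comm (E t)]

theorem mapJ_mem_space (hE : IsHermiteBiehler E) (hF : Differentiable ℂ F) {g : ℂ → ℂ}
    (hg : g ∈ space F) : mapJ E g ∈ space (E * F) := by
  rw [mem_space_iff] at hg ⊢
  have hd : Differentiable ℂ (mapJ E g) := hg.1.mul (differentiable_starFn hE.1)
  refine ⟨hd, hg.2.1.of_le (aestronglyMeasurable_div (hE.1.mul hF) hd)
      (Eventually.of_forall fun t => ?_),
    (hg.2.2.1.mul_bounded (hE.differentiableOn_div (differentiable_starFn hE.1))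
      fun z hz => hE.norm_starFn_div_le hz).congr fun z hz => ?_, hg.2.2.2.congr fun z hz => ?_⟩
  · rw [mapJ_div_ofReal, norm_mul, norm_div (conj _), RCLike.norm_conj]
    exact mul_le_of_le_one_right (norm_nonneg _) (div_self_le_one _)
  · simp only [mapJ, Pi.mul_apply, div_mul_div_comm, mul_comm (F z)]
  · simp only [mapJ, Pi.mul_apply, starFn, map_mul, conj_conj]
    rw [mul_comm (E z), mul_div_mul_right _ _ (hE.ne_zero hz)]

theorem ip_mapJ (hE : IsHermiteBiehler E) (g₁ g₂ : ℂ → ℂ) :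
    ip (E * F) (mapJ E g₁) (mapJ E g₂) = ip F g₁ g₂ := by
  rw [ip_eq_integral, ip_eq_integral]
  refine integral_congr_ae ?_
  filter_upwards [hE.ae_ne_zero] with t ht
  have ht' : conj (E t) ≠ 0 := by simpa using ht
  rw [mapJ_div_ofReal, mapJ_div_ofReal]
  simp only [map_mul, map_div₀, conj_conj]
  field_simp

end Maps

/-! ### Embedding in `L²(ℝ)` and closedness of the image. -/

/-- The de Branges space as a submodule of the functions on `ℂ`. -/
def spaceSubmodule (E : ℂ → ℂ) : Submodule ℂ (ℂ → ℂ) where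
  carrier := space E
  add_mem' := add_mem_space
  zero_mem' := zero_mem_space E
  smul_mem' := fun c _ hf => const_mul_mem_space c hf

theorem memLp_div {E : ℂ → ℂ} (f : spaceSubmodule E) :
    MemLp (fun t : ℝ => (f : ℂ → ℂ) t / E t) 2 :=
  (mem_space_iff.1 f.2).2.1

/-- The embedding `f ↦ f / E` of the de Branges space in `L²(ℝ)`. -/
def toL2 (E : ℂ → ℂ) : spaceSubmodule E →ₗ[ℂ] Lp ℂ 2 (volume : Measure ℝ) where
  toFun f := (memLp_div f).toLp
  map_add' f g := by
    rw [← MemLp.toLp_add, MemLp.toLp_eq_toLp_iff]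
    exact Eventually.of_forall fun t => by simp [add_div]
  map_smul' c f := by
    rw [RingHom.id_apply, ← MemLp.toLp_const_smul, MemLp.toLp_eq_toLp_iff]
    exact Eventually.of_forall fun t => by simp [mul_div_assoc]

theorem coeFn_toL2 {E : ℂ → ℂ} (f : spaceSubmodule E) :
    toL2 E f =ᵐ[volume] fun t : ℝ => (f : ℂ → ℂ) t / E t :=
  MemLp.coeFn_toLp (memLp_div f)

theorem inner_toL2 {E : ℂ → ℂ} (f g : spaceSubmodule E) :
    inner ℂ (toL2 E g) (toL2 E f) = ip E f g := by
  rw [L2.inner_def, ip_eq_integral]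
  refine integral_congr_ae ?_
  filter_upwards [coeFn_toL2 f, coeFn_toL2 g] with t h1 h2
  rw [h1, h2, RCLike.inner_apply]

/-- The reproducing kernel as an element of the de Branges space. -/
def kernelElt {E : ℂ → ℂ} (hE : IsHermiteBiehler E) (w : ℂ) : spaceSubmodule E :=
  ⟨kernel E w, kernel_mem_space hE w⟩

theorem apply_eq_inner {E : ℂ → ℂ} (hE : IsHermiteBiehler E) (f : spaceSubmodule E) (w : ℂ) :
    (f : ℂ → ℂ) w = inner ℂ (toL2 E (kernelElt hE w)) (toL2 E f) := by
  rw [inner_toL2]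
  exact (isReproducingKernel_kernel hE w).2 f f.2

theorem eq_zero_of_toL2_eq_zero {E : ℂ → ℂ} (hE : IsHermiteBiehler E) {f : spaceSubmodule E}
    (h : toL2 E f = 0) : f = 0 := by
  ext w
  rw [apply_eq_inner hE, h, inner_zero_right]
  rfl

/-- Cauchy–Schwarz with `‖K_w‖² = K(w, w) ≤ B`. The bound `B` is available off the antidiagonal
only, so real `w` are reached as limits from above. -/
theorem exists_eval_bound {E : ℂ → ℂ} (hE : IsHermiteBiehler E) (R : ℝ) :
    ∃ C : ℝ, 0 ≤ C ∧ ∀ f : spaceSubmodule E, ∀ w ∈ closedBall (0 : ℂ) R,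
      ‖(f : ℂ → ℂ) w‖ ≤ C * ‖toL2 E f‖ := by
  obtain ⟨B, hB0, hB⟩ := exists_kernel_bound hE.1 (R + 1)
  have key : ∀ f : spaceSubmodule E, ∀ w ∈ closedBall (0 : ℂ) (R + 1), w.im ≠ 0 →
      ‖(f : ℂ → ℂ) w‖ ≤ √B * ‖toL2 E f‖ := by
    intro f w hw him
    rw [apply_eq_inner hE]
    refine (norm_inner_le_norm _ _).trans ?_
    gcongr
    refine Real.le_sqrt_of_sq_le ?_
    have h1 := apply_eq_inner hE (kernelElt hE w) w
    have h2 := hB w hw w hw (fun h => him (by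
      have := congrArg im h
      rw [conj_im] at this
      linarith))
    have h3 : ‖(inner ℂ (toL2 E (kernelElt hE w)) (toL2 E (kernelElt hE w)) : ℂ)‖ =
        ‖toL2 E (kernelElt hE w)‖ ^ 2 := by
      rw [inner_self_eq_norm_sq_to_K, norm_pow]
      simp
    rw [← h3, ← h1]
    exact h2
  refine ⟨√B, by positivity, fun f w hw => ?_⟩
  by_cases him : w.im = 0
  · have hc := (mem_space_iff.1 f.2).1.continuous
    have ht : Tendsto (fun η : ℝ => ‖(f : ℂ → ℂ) (w + η * I)‖) (𝓝[>] 0)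
        (𝓝 ‖(f : ℂ → ℂ) w‖) := by
      have : Continuous fun η : ℝ => ‖(f : ℂ → ℂ) (w + η * I)‖ := by fun_prop
      simpa using (this.tendsto 0).mono_left (nhdsWithin_le_nhds (s := Ioi 0))
    refine le_of_tendsto ht ?_
    filter_upwards [Ioo_mem_nhdsGT one_pos] with η hη
    refine key f _ ?_ (by simpa [him] using hη.1.ne')
    rw [mem_closedBall_zero_iff] at hw ⊢
    refine (norm_add_le _ _).trans ?_
    rw [norm_mul, norm_I, norm_real, Real.norm_of_nonneg hη.1.le]
    linarith [hη.2]
  · exact key f w (closedBall_subset_closedBall (by linarith) hw) him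

/-- At a fixed nonreal point the Cauchy integral is an inner product with a fixed `L²` function. -/
theorem tendsto_cauchyInt {u : ℕ → Lp ℂ 2 (volume : Measure ℝ)} {v : Lp ℂ 2 (volume : Measure ℝ)}
    (h : Tendsto u atTop (𝓝 v)) {z : ℂ} (hz : z.im ≠ 0) :
    Tendsto (fun n => cauchyInt (u n) z) atTop (𝓝 (cauchyInt v z)) := by
  have hm : MemLp (fun t : ℝ => conj (((t : ℂ) - z)⁻¹)) 2 := (memLp_inv_ofReal_sub hz).star
  have key : ∀ u : Lp ℂ 2 (volume : Measure ℝ), cauchyInt u z = inner ℂ hm.toLp u := by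
    intro u
    rw [L2.inner_def, cauchyInt]
    refine integral_congr_ae ?_
    filter_upwards [hm.coeFn_toLp] with t ht
    rw [ht, RCLike.inner_apply, conj_conj, div_eq_mul_inv]
  simp_rw [key]
  exact tendsto_const_nhds.inner h

/-- An entire pointwise limit of an `L²`-convergent sequence in the de Branges space. -/
theorem ae_eq_and_isSmirnov_of_tendsto {E : ℂ → ℂ} (hE : IsHermiteBiehler E)
    {f : ℕ → spaceSubmodule E} {v : Lp ℂ 2 (volume : Measure ℝ)}
    (hv : Tendsto (fun n => toL2 E (f n)) atTop (𝓝 v)) {g : ℂ → ℂ} (hg : Differentiable ℂ g)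
    (hfg : ∀ z, Tendsto (fun n => (f n : ℂ → ℂ) z) atTop (𝓝 (g z))) :
    v =ᵐ[volume] (fun t : ℝ => g t / E t) ∧ IsSmirnov fun z => g z / E z := by
  have hae : v =ᵐ[volume] fun t : ℝ => g t / E t := by
    obtain ⟨ns, hns, hlim⟩ := (tendstoInMeasure_of_tendsto_Lp hv).exists_seq_tendsto_ae
    have hall : ∀ᵐ t : ℝ, ∀ n, toL2 E (f n) t = (f n : ℂ → ℂ) t / E t :=
      ae_all_iff.2 fun n => coeFn_toL2 (f n)
    filter_upwards [hlim, hall] with t h1 h2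
    refine tendsto_nhds_unique h1 ?_
    simp_rw [h2]
    exact ((hfg t).comp hns.tendsto_atTop).div_const _
  refine ⟨hae, isSmirnov_of_cauchyInt (Lp.memLp v) (hE.differentiableOn_div hg)
    (fun z hz => ?_) fun z hz => ?_⟩
  · refine tendsto_nhds_unique (tendsto_cauchyInt hv (ne_of_gt hz)) ?_
    have : ∀ n, cauchyInt (toL2 E (f n)) z = 2 * Real.pi * I * ((f n : ℂ → ℂ) z / E z) := fun n => by
      rw [cauchyInt_congr (coeFn_toL2 (f n)), (hE.cauchyInt_eq (f n).2).1 z hz]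
    simp_rw [this]
    exact ((hfg z).div_const _).const_mul _
  · refine tendsto_nhds_unique (tendsto_cauchyInt hv (ne_of_lt hz)) ?_
    have : ∀ n, cauchyInt (toL2 E (f n)) z = 0 := fun n => by
      rw [cauchyInt_congr (coeFn_toL2 (f n)), (hE.cauchyInt_eq (f n).2).2 z hz]
    simp_rw [this]
    exact tendsto_const_nhds

theorem norm_toL2_eq_of_norm_eq {E F f g : ℂ → ℂ} (hf : f ∈ space E) (hg : g ∈ space F)
    (h : ∀ᵐ t : ℝ, ‖f t / E t‖ = ‖g t / F t‖) :
    ‖toL2 E ⟨f, hf⟩‖ = ‖toL2 F ⟨g, hg⟩‖ := by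
  refine congrArg ENNReal.toReal (eLpNorm_congr_norm_ae ?_)
  filter_upwards [h, coeFn_toL2 ⟨f, hf⟩, coeFn_toL2 ⟨g, hg⟩] with t h1 h2 h3
  rw [h2, h3, h1]

/-- The image of the de Branges space in `L²(ℝ)` is closed. -/
theorem isClosed_range_toL2 {E : ℂ → ℂ} (hE : IsHermiteBiehler E) :
    IsClosed ((LinearMap.range (toL2 E) : Submodule ℂ (Lp ℂ 2 (volume : Measure ℝ))) :
      Set (Lp ℂ 2 (volume : Measure ℝ))) := by
  refine IsSeqClosed.isClosed fun u v hu hv => ?_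
  choose f hf using hu
  have hv' : Tendsto (fun n => toL2 E (f n)) atTop (𝓝 v) := by simpa only [hf] using hv
  have hcs := hv'.cauchySeq
  -- Evaluation bounds convert `L²` convergence into locally uniform convergence, so the limit is
  -- entire.
  have hunif : ∀ R : ℝ, UniformCauchySeqOn (fun n z => (f n : ℂ → ℂ) z) atTop (closedBall 0 R) := by
    intro R
    obtain ⟨C, hC0, hC⟩ := exists_eval_bound hE R
    rw [Metric.uniformCauchySeqOn_iff]
    intro ε hε
    obtain ⟨N, hN⟩ := Metric.cauchySeq_iff.1 hcs (ε / (C + 1)) (by positivity)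
    refine ⟨N, fun m hm n hn z hz => ?_⟩
    have h1 := hN m hm n hn
    have h2 := hC (f m - f n) z hz
    rw [map_sub, ← dist_eq_norm] at h2
    rw [lt_div_iff₀ (by positivity)] at h1
    rw [dist_eq_norm]
    have h3 : ((f m - f n : spaceSubmodule E) : ℂ → ℂ) z = (f m : ℂ → ℂ) z - (f n : ℂ → ℂ) z := rfl
    rw [h3] at h2
    have := dist_nonneg (x := toL2 E (f m)) (y := toL2 E (f n))
    nlinarith
  have hpt : ∀ z, ∃ y, Tendsto (fun n => (f n : ℂ → ℂ) z) atTop (𝓝 y) := fun z =>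
    cauchySeq_tendsto_of_complete ((hunif ‖z‖).cauchySeq (by simp))
  choose g hg using hpt
  have hgd : Differentiable ℂ g := by
    rw [← differentiableOn_univ]
    have hloc : TendstoLocallyUniformlyOn (fun n z => (f n : ℂ → ℂ) z) g atTop univ := by
      rw [tendstoLocallyUniformlyOn_iff_forall_isCompact isOpen_univ]
      intro K _ hK
      obtain ⟨R, hR⟩ := hK.isBounded.subset_closedBall 0
      exact ((hunif R).tendstoUniformlyOn_of_tendsto fun z _ => hg z).mono hR
    exact hloc.differentiableOn (Eventually.of_forall fun n =>
      (mem_space_iff.1 (f n).2).1.differentiableOn) isOpen_univ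
  obtain ⟨hae, hs⟩ := ae_eq_and_isSmirnov_of_tendsto hE hv' hgd hg
  -- The involution preserves the norm, so the starred sequence converges as well; its limit
  -- supplies the conditions on `g*/E`.
  set fs : ℕ → spaceSubmodule E := fun n => ⟨starFn (f n), starFn_mem_space hE.1 (f n).2⟩
  have hcs' : CauchySeq fun n => toL2 E (fs n) := by
    have hd : ∀ m n, dist (toL2 E (fs m)) (toL2 E (fs n)) = dist (toL2 E (f m)) (toL2 E (f n)) := by
      intro m n
      rw [dist_eq_norm, dist_eq_norm, ← map_sub, ← map_sub]
      refine norm_toL2_eq_of_norm_eq (fs m - fs n).2 (f m - f n).2 (Eventually.of_forall fun t => ?_)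
      rw [norm_div, norm_div]
      congr 1
      show ‖starFn (f m) t - starFn (f n) t‖ = ‖(f m : ℂ → ℂ) t - (f n : ℂ → ℂ) t‖
      rw [starFn_ofReal, starFn_ofReal, ← map_sub, RCLike.norm_conj]
    simpa only [Metric.cauchySeq_iff, hd] using hcs
  obtain ⟨vs, hvs⟩ := cauchySeq_tendsto_of_complete hcs'
  obtain ⟨-, hs'⟩ := ae_eq_and_isSmirnov_of_tendsto hE hvs (differentiable_starFn hgd)
    fun z => (continuous_conj.tendsto _).comp (hg (conj z))
  have hgm : g ∈ space E :=
    mem_space_iff.2 ⟨hgd, (memLp_congr_ae hae).1 (Lp.memLp v), hs, hs'⟩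
  exact ⟨⟨g, hgm⟩, Lp.ext ((coeFn_toL2 _).trans hae.symm)⟩

end DeBranges
end

/-! ### Orthogonality and the decomposition of `H(EF)`. -/

noncomputable section
namespace DeBranges
open Complex Metric Set Filter Topology MeasureTheory

/-- Used to transfer closedness from the image of `H(F)` to its image under `J`. -/
theorem isClosed_range_of_norm_eq {V X : Type*} [AddCommGroup V] [Module ℂ V]
    [NormedAddCommGroup X] [NormedSpace ℂ X] [CompleteSpace X] {A B : V →ₗ[ℂ] X}
    (h : ∀ v, ‖A v‖ = ‖B v‖) (hA : IsClosed (LinearMap.range A : Set X)) :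
    IsClosed (LinearMap.range B : Set X) := by
  refine IsSeqClosed.isClosed fun u x hu hx => ?_
  choose v hv using hu
  have hx' : Tendsto (fun n => B (v n)) atTop (𝓝 x) := by simpa only [hv] using hx
  have hcs : CauchySeq fun n => A (v n) := by
    have hd : ∀ m n, dist (A (v m)) (A (v n)) = dist (B (v m)) (B (v n)) := fun m n => by
      rw [dist_eq_norm, dist_eq_norm, ← map_sub, ← map_sub, h]
    simpa only [Metric.cauchySeq_iff, hd] using hx'.cauchySeq
  obtain ⟨y, hy⟩ := cauchySeq_tendsto_of_complete hcs
  obtain ⟨a, rfl⟩ := hA.mem_of_tendsto hy (Eventually.of_forall fun n => ⟨v n, rfl⟩)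
  refine ⟨a, tendsto_nhds_unique ?_ hx'⟩
  rw [tendsto_iff_norm_sub_tendsto_zero] at hy ⊢
  simpa only [← map_sub, h] using hy

section Decomposition

variable {E F : ℂ → ℂ}

/-- Multiplication by `F` as a linear map between de Branges spaces. -/
def mapILin (hF : IsHermiteBiehler F) : spaceSubmodule E →ₗ[ℂ] spaceSubmodule (E * F) where
  toFun f := ⟨mapI F f, mapI_mem_space hF f.2⟩
  map_add' f g := Subtype.ext (funext fun z => add_mul ((f : ℂ → ℂ) z) ((g : ℂ → ℂ) z) (F z))
  map_smul' c f := Subtype.ext (funext fun z => mul_assoc c ((f : ℂ → ℂ) z) (F z))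

/-- Multiplication by `E*` as a linear map between de Branges spaces. -/
def mapJLin (hE : IsHermiteBiehler E) (hF : IsHermiteBiehler F) :
    spaceSubmodule F →ₗ[ℂ] spaceSubmodule (E * F) where
  toFun g := ⟨mapJ E g, mapJ_mem_space hE hF.1 g.2⟩
  map_add' f g := Subtype.ext (funext fun z =>
    add_mul ((f : ℂ → ℂ) z) ((g : ℂ → ℂ) z) (starFn E z))
  map_smul' c f := Subtype.ext (funext fun z => mul_assoc c ((f : ℂ → ℂ) z) (starFn E z))

theorem toL2_mapILin (hF : IsHermiteBiehler F) (f : spaceSubmodule E) :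
    toL2 (E * F) (mapILin hF f) = toL2 E f :=
  Lp.ext ((coeFn_toL2 _).trans ((mapI_div_ae hF f).trans (coeFn_toL2 f).symm))

theorem norm_toL2_mapJLin (hE : IsHermiteBiehler E) (hF : IsHermiteBiehler F)
    (g : spaceSubmodule F) : ‖toL2 F g‖ = ‖toL2 (E * F) (mapJLin hE hF g)‖ := by
  have h : (inner ℂ (toL2 F g) (toL2 F g) : ℂ) =
      inner ℂ (toL2 (E * F) (mapJLin hE hF g)) (toL2 (E * F) (mapJLin hE hF g)) := by
    rw [inner_toL2, inner_toL2]
    exact (ip_mapJ hE _ _).symm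
  rw [@norm_eq_sqrt_re_inner ℂ, h, ← @norm_eq_sqrt_re_inner ℂ]

theorem kernelElt_mul (hE : IsHermiteBiehler E) (hF : IsHermiteBiehler F) (w : ℂ) :
    kernelElt (hE.mul hF) w = conj (F w) • mapILin hF (kernelElt hE w) +
      E (conj w) • mapJLin hE hF (kernelElt hF w) :=
  Subtype.ext (kernel_mul_identity hE.1 hF.1 w)

theorem inner_mapJLin (hE : IsHermiteBiehler E) (hF : IsHermiteBiehler F)
    (g₁ g₂ : spaceSubmodule F) :
    inner ℂ (toL2 (E * F) (mapJLin hE hF g₁)) (toL2 (E * F) (mapJLin hE hF g₂)) =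
      inner ℂ (toL2 F g₁) (toL2 F g₂) := by
  rw [inner_toL2, inner_toL2]
  exact ip_mapJ hE _ _

/-- Evaluate `J g` at `w` and expand `K_EF(w, ·)` by the kernel identity: the `K_F` term equals
`E*(w) g(w)`, the whole left side. The remaining term is `F(w)` times the inner product, and `F(w) ≠
0`. -/
theorem inner_kernelElt_mapJLin (hE : IsHermiteBiehler E) (hF : IsHermiteBiehler F)
    (g : spaceSubmodule F) {w : ℂ} (hw : w ∈ upperHalf) :
    inner ℂ (toL2 E (kernelElt hE w)) (toL2 (E * F) (mapJLin hE hF g)) = 0 := by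
  have h1 := apply_eq_inner (hE.mul hF) (mapJLin hE hF g) w
  rw [kernelElt_mul hE hF, map_add, map_smul, map_smul, inner_add_left, inner_smul_left,
    inner_smul_left, inner_mapJLin, ← apply_eq_inner hF, toL2_mapILin, conj_conj] at h1
  have h2 : ((mapJLin hE hF g : spaceSubmodule (E * F)) : ℂ → ℂ) w =
      conj (E (conj w)) * (g : ℂ → ℂ) w := mul_comm _ _
  rw [h2, right_eq_add] at h1
  exact (mul_eq_zero.1 h1).resolve_left (hF.ne_zero hw)

theorem eq_zero_of_eqOn_upperHalf {f : ℂ → ℂ} (hf : Differentiable ℂ f)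
    (h : ∀ z ∈ upperHalf, f z = 0) : f = 0 := by
  have ha : AnalyticOnNhd ℂ f univ := fun z _ => hf.analyticAt z
  have hI : I ∈ upperHalf := by show 0 < I.im; simp
  funext z
  exact ha.eqOn_zero_of_preconnected_of_eventuallyEq_zero isPreconnected_univ (mem_univ I)
    (mem_of_superset (isOpen_upperHalf.mem_nhds hI) h) (mem_univ z)

/-- Let `r ∈ H(E)` represent the projection of `J g` on the closed image of `H(E)`. Then `r(w) = ⟨J
g, I K_E(w, ·)⟩ = 0` on `ℂ⁺`, so `r = 0` and `J g` is orthogonal to the whole image. -/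
theorem inner_mapILin_mapJLin (hE : IsHermiteBiehler E) (hF : IsHermiteBiehler F)
    (f : spaceSubmodule E) (g : spaceSubmodule F) :
    inner ℂ (toL2 E f) (toL2 (E * F) (mapJLin hE hF g)) = 0 := by
  have : CompleteSpace (LinearMap.range (toL2 E)) :=
    (isClosed_range_toL2 hE).completeSpace_coe
  set u := toL2 (E * F) (mapJLin hE hF g)
  obtain ⟨r, hr⟩ := ((LinearMap.range (toL2 E)).orthogonalProjectionOnto u).2
  have hperp : ∀ f, inner ℂ (toL2 E f) (u - toL2 E r) = 0 := fun f => by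
    rw [hr]
    exact Submodule.sub_starProjection_mem_orthogonal u _ ⟨f, rfl⟩
  have hr0 : r = 0 := by
    refine Subtype.ext (eq_zero_of_eqOn_upperHalf (mem_space_iff.1 r.2).1 fun w hw => ?_)
    have h1 := hperp (kernelElt hE w)
    rw [inner_sub_right, inner_kernelElt_mapJLin hE hF g hw, ← apply_eq_inner hE, zero_sub,
      neg_eq_zero] at h1
    exact h1
  simpa [hr0] using hperp f

/-- Take for `f` and `g` the projections of `h` on the two closed images. By orthogonality the
remainder is orthogonal to both, hence to every `K_EF(w, ·)`, so it vanishes at each point. -/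
theorem exists_decomposition (hE : IsHermiteBiehler E) (hF : IsHermiteBiehler F)
    (h : spaceSubmodule (E * F)) : ∃ f : spaceSubmodule E, ∃ g : spaceSubmodule F,
      h = mapILin hF f + mapJLin hE hF g := by
  have : CompleteSpace (LinearMap.range (toL2 E)) :=
    (isClosed_range_toL2 hE).completeSpace_coe
  set T := toL2 (E * F) ∘ₗ mapJLin hE hF
  have : CompleteSpace (LinearMap.range T) :=
    (isClosed_range_of_norm_eq (B := T) (norm_toL2_mapJLin hE hF)
      (isClosed_range_toL2 hF)).completeSpace_coe
  set u := toL2 (E * F) h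
  obtain ⟨f, hf⟩ := ((LinearMap.range (toL2 E)).orthogonalProjectionOnto u).2
  obtain ⟨g, hg⟩ := ((LinearMap.range T).orthogonalProjectionOnto u).2
  have hperp₁ : ∀ a, inner ℂ (toL2 E a) (u - toL2 E f) = 0 := fun a => by
    rw [hf]
    exact Submodule.sub_starProjection_mem_orthogonal u _ ⟨a, rfl⟩
  have hperp₂ : ∀ a, inner ℂ (T a) (u - T g) = 0 := fun a => by
    rw [hg]
    exact Submodule.sub_starProjection_mem_orthogonal u _ ⟨a, rfl⟩
  refine ⟨f, g, sub_eq_zero.1 (Subtype.ext (funext fun w => ?_))⟩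
  have hsub : toL2 (E * F) (h - (mapILin hF f + mapJLin hE hF g)) = u - toL2 E f - T g := by
    rw [map_sub, map_add, toL2_mapILin, ← sub_sub]
    rfl
  rw [apply_eq_inner (hE.mul hF), kernelElt_mul hE hF, hsub, map_add, map_smul, map_smul, inner_add_left,
    inner_smul_left, inner_smul_left, toL2_mapILin, inner_sub_right, hperp₁, sub_right_comm]
  have h1 := hperp₂ (kernelElt hF w)
  have h2 := inner_mapILin_mapJLin hE hF (kernelElt hE w) g
  have h3 := inner_eq_zero_symm.1 (inner_mapILin_mapJLin hE hF f (kernelElt hF w))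
  simp only [T, LinearMap.comp_apply] at h1 ⊢
  rw [inner_sub_right, h1, h2, h3]
  simp

theorem decomposition_unique (hE : IsHermiteBiehler E) (hF : IsHermiteBiehler F)
    {f : spaceSubmodule E} {g : spaceSubmodule F} (h : mapILin hF f + mapJLin hE hF g = 0) :
    f = 0 ∧ g = 0 := by
  have h0 : toL2 E f + toL2 (E * F) (mapJLin hE hF g) = 0 := by
    rw [← toL2_mapILin hF, ← map_add, h, map_zero]
  have hperp := inner_mapILin_mapJLin hE hF f g
  have hf : toL2 E f = 0 := by
    rw [← inner_self_eq_zero (𝕜 := ℂ)]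
    have := congrArg (inner ℂ (toL2 E f)) h0
    rwa [inner_add_right, hperp, inner_zero_right, add_zero] at this
  refine ⟨eq_zero_of_toL2_eq_zero hE hf, eq_zero_of_toL2_eq_zero hF ?_⟩
  rw [hf, zero_add] at h0
  rw [← norm_eq_zero, norm_toL2_mapJLin hE hF, h0, norm_zero]

end Decomposition

end DeBranges
end

theorem lemmaL (E F : ℂ → ℂ) (hE : DeBranges.IsHermiteBiehler E)
    (hF : DeBranges.IsHermiteBiehler F) :
    -- `I : H(E) → H(EF)` and `J : H(F) → H(EF)` are well defined and isometric
    (∀ f ∈ DeBranges.space E, DeBranges.mapI F f ∈ DeBranges.space (E * F)) ∧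
    (∀ f₁ ∈ DeBranges.space E, ∀ f₂ ∈ DeBranges.space E,
      DeBranges.ip (E * F) (DeBranges.mapI F f₁) (DeBranges.mapI F f₂) = DeBranges.ip E f₁ f₂) ∧
    (∀ g ∈ DeBranges.space F, DeBranges.mapJ E g ∈ DeBranges.space (E * F)) ∧
    (∀ g₁ ∈ DeBranges.space F, ∀ g₂ ∈ DeBranges.space F,
      DeBranges.ip (E * F) (DeBranges.mapJ E g₁) (DeBranges.mapJ E g₂) = DeBranges.ip F g₁ g₂) ∧
    -- their images are orthogonal in `H(EF)`
    (∀ f ∈ DeBranges.space E, ∀ g ∈ DeBranges.space F,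
      DeBranges.ip (E * F) (DeBranges.mapI F f) (DeBranges.mapJ E g) = 0) ∧
    -- together they span `H(EF)`, with unique components
    (∀ h : ℂ → ℂ, h ∈ DeBranges.space (E * F) ↔
      ∃! p : (ℂ → ℂ) × (ℂ → ℂ), p.1 ∈ DeBranges.space E ∧ p.2 ∈ DeBranges.space F ∧
        h = DeBranges.mapI F p.1 + DeBranges.mapJ E p.2) ∧
    -- the reproducing kernels and the kernel identity
    DeBranges.IsReproducingKernel E (DeBranges.kernel E) ∧
    DeBranges.IsReproducingKernel F (DeBranges.kernel F) ∧
    DeBranges.IsReproducingKernel (E * F) (DeBranges.kernel (E * F)) ∧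
    (∀ w : ℂ, DeBranges.kernel (E * F) w =
      conj (F w) • DeBranges.mapI F (DeBranges.kernel E w) +
        E (conj w) • DeBranges.mapJ E (DeBranges.kernel F w)) := by
  open DeBranges in
  refine ⟨fun f hf => mapI_mem_space hF hf, fun f₁ _ f₂ _ => ip_mapI hF f₁ f₂,
    fun g hg => mapJ_mem_space hE hF.1 hg, fun g₁ _ g₂ _ => ip_mapJ hE g₁ g₂,
    fun f hf g hg => ?_, fun h => ⟨fun hh => ?_, ?_⟩, isReproducingKernel_kernel hE,
    isReproducingKernel_kernel hF, isReproducingKernel_kernel (hE.mul hF),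
    kernel_mul_identity hE.1 hF.1⟩
  · have h1 := inner_eq_zero_symm.1 (inner_mapILin_mapJLin hE hF ⟨f, hf⟩ ⟨g, hg⟩)
    rwa [← toL2_mapILin hF ⟨f, hf⟩, inner_toL2] at h1
  · obtain ⟨f, g, hfg⟩ := exists_decomposition hE hF ⟨h, hh⟩
    have hfg' : h = mapI F f + mapJ E g := congrArg Subtype.val hfg
    refine ⟨(f, g), ⟨f.2, g.2, hfg'⟩, ?_⟩
    rintro ⟨f', g'⟩ ⟨hf', hg', hh'⟩
    simp only at hf' hg' hh'
    have h0 : mapILin hF (⟨f', hf'⟩ - f) + mapJLin hE hF (⟨g', hg'⟩ - g) = 0 := by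
      rw [map_sub, map_sub, sub_add_sub_comm, ← hfg, sub_eq_zero]
      exact Subtype.ext hh'.symm
    obtain ⟨h1, h2⟩ := decomposition_unique hE hF h0
    exact Prod.ext (congrArg Subtype.val (sub_eq_zero.1 h1))
      (congrArg Subtype.val (sub_eq_zero.1 h2))
  · rintro ⟨⟨f, g⟩, ⟨hf, hg, rfl⟩, -⟩
    exact add_mem_space (mapI_mem_space hF hf) (mapJ_mem_space hE hF.1 hg)
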